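/- Let $p$ be a prime and let $G$ be a (topologically) finitely generated pro-$p$ group of rank $d$, i.e. $d$ is the minimal number of topological generators of $G$. Assume that $G={*}_{i\in I}G_i$ is the free pro-$p$ product of a finite family of pro-$p$ groups $G_i$ ($|I|=1$ is allowed), where each $G_i$ is either a free pro-$p$ group or a Demushkin group. Here a pro-$p$ group $D$ is called a Demushkin group if $\dim_{\mathbb F_p}H^1(D,\mathbb F_p)<\infty$, $\dim_{\mathbb F_p}H^2(D,\mathbb F_p)=1$ and the cup product $H^1(D,\mathbb F_p)\times H^1(D,\mathbb F_p)\to H^2(D,\mathbb F_p)$ is non-degenerate, where $H^\bullet$ is continuous cohomology. Let $n\ge 2$ be a natural number, and let $\mathbb U_n(\mathbb F_p)$ be the group of upper-triangular unipotent $n\times n$ matrices over $\mathbb F_p$. Exclude only the case where $n=3$, $d=2$ and $G$ itself is a Demushkin group with $\chi\cup\chi=0$ for all $\chi\in H^1(G,\mathbb F_p)$ (for example $G=\mathbb Z_p^2$). Then there is a continuous surjective homomorphism $G\to\mathbb U_n(\mathbb F_p)$ if and only if $n\le d+1$. -/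

import Mathlib

universe u v

open Filter Topology

/-! ### Pro-`p` groups, rank -/

/-- A topological group is a pro-`p` group: it is profinite and each of its quotients by an open
normal subgroup is a `p`-group (finite, by compactness). -/
structure IsProP (p : ℕ) (G : Type u) [Group G] [TopologicalSpace G] [IsTopologicalGroup G] :
    Prop where
  compactSpace : CompactSpace G
  totallyDisconnectedSpace : TotallyDisconnectedSpace G
  isPGroup_quotient : ∀ (N : Subgroup G) [N.Normal], IsOpen (N : Set G) → IsPGroup p (G ⧸ N)

/-- `G` is topologically finitely generated and `d` is its minimal number of topological
generators. -/
def HasRank (G : Type u) [Group G] [TopologicalSpace G] [IsTopologicalGroup G] (d : ℕ) : Prop :=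
  IsLeast {k : ℕ | ∃ s : Finset G, s.card = k ∧
    (Subgroup.closure (s : Set G)).topologicalClosure = ⊤} d

/-! ### Free pro-`p` groups and free pro-`p` products -/

/-- `G` is a free pro-`p` group: there is a set `X` and a map `b : X → G` converging to `1`
(every neighbourhood of `1` contains all but finitely many of the `b x`; no condition when `X` is
finite) which is universal among the maps converging to `1` from `X` to pro-`p` groups. -/
def IsFreeProP (p : ℕ) (G : Type u) [Group G] [TopologicalSpace G] [IsTopologicalGroup G] :
    Prop :=
  IsProP p G ∧ ∃ (X : Type u) (b : X → G), Tendsto b cofinite (𝓝 1) ∧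
    ∀ (H : Type u) [Group H] [TopologicalSpace H] [IsTopologicalGroup H], IsProP p H →
      ∀ f : X → H, Tendsto f cofinite (𝓝 1) → ∃! φ : G →ₜ* H, ∀ x, φ (b x) = f x

/-- `G`, with the continuous homomorphisms `ι i : A i → G`, is the free pro-`p` product of the
family `A` (to be used for finite families): it is the coproduct of the family in the category of
pro-`p` groups and continuous homomorphisms. -/
def IsFreeProPProduct (p : ℕ) {I : Type v} (A : I → Type u) [∀ i, Group (A i)]
    [∀ i, TopologicalSpace (A i)] (G : Type u) [Group G] [TopologicalSpace G]
    [IsTopologicalGroup G] (ι : ∀ i, A i →ₜ* G) : Prop :=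
  IsProP p G ∧
    ∀ (H : Type u) [Group H] [TopologicalSpace H] [IsTopologicalGroup H], IsProP p H →
      ∀ ψ : ∀ i, A i →ₜ* H, ∃! φ : G →ₜ* H, ∀ i x, φ (ι i x) = ψ i x

/-! ### Continuous cohomology with coefficients in `𝔽_p` in degrees one and two

Inhomogeneous continuous cochains with values in the trivial discrete module `𝔽_p`
(`ZMod p` carries the discrete topology). -/

noncomputable section

section Cohomology

variable (p : ℕ) (G : Type u) [Group G] [TopologicalSpace G] [IsTopologicalGroup G]

/-- The differential `C¹(G, 𝔽_p) → C²(G, 𝔽_p)`, `(δf)(g, h) = f h - f (g h) + f g`. -/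
def cochainD1 : C(G, ZMod p) →ₗ[ZMod p] C(G × G, ZMod p) where
  toFun f := ⟨fun x => f x.2 - f (x.1 * x.2) + f x.1, by fun_prop⟩
  map_add' f g := by ext x; simp; ring
  map_smul' c f := by ext x; simp; ring

/-- The differential `C²(G, 𝔽_p) → C³(G, 𝔽_p)`,
`(δc)(g, h, k) = c (h, k) - c (g h, k) + c (g, h k) - c (g, h)`. -/
def cochainD2 : C(G × G, ZMod p) →ₗ[ZMod p] C(G × G × G, ZMod p) where
  toFun c := ⟨fun x => c (x.2.1, x.2.2) - c (x.1 * x.2.1, x.2.2) + c (x.1, x.2.1 * x.2.2)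
    - c (x.1, x.2.1), by fun_prop⟩
  map_add' f g := by ext x; simp; ring
  map_smul' c f := by ext x; simp; ring

theorem cochainD2_cochainD1 (f : C(G, ZMod p)) : cochainD2 p G (cochainD1 p G f) = 0 := by
  ext x
  simp [cochainD1, cochainD2, mul_assoc]
  ring

/-- `H¹(G, 𝔽_p) = Z¹(G, 𝔽_p)`, the continuous homomorphisms `G → 𝔽_p` (the action being trivial,
there are no nonzero coboundaries). -/
abbrev H1 : Type u := LinearMap.ker (cochainD1 p G)

/-- The continuous `2`-cocycles. -/
abbrev Z2 : Submodule (ZMod p) C(G × G, ZMod p) := LinearMap.ker (cochainD2 p G)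

/-- The continuous `2`-coboundaries. -/
abbrev B2 : Submodule (ZMod p) C(G × G, ZMod p) := LinearMap.range (cochainD1 p G)

theorem B2_le_Z2 : B2 p G ≤ Z2 p G := by
  rintro _ ⟨f, rfl⟩
  exact cochainD2_cochainD1 p G f

/-- `H²(G, 𝔽_p)`. -/
abbrev H2 : Type u := Z2 p G ⧸ (B2 p G).submoduleOf (Z2 p G)

variable {G}

/-- The cup product of two `1`-cochains, `(f ∪ g)(x, y) = f x * g y`. -/
def cupCochain (f g : C(G, ZMod p)) : C(G × G, ZMod p) :=
  ⟨fun x => f x.1 * g x.2, by fun_prop⟩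

theorem map_mul_of_mem_ker {f : C(G, ZMod p)} (hf : f ∈ LinearMap.ker (cochainD1 p G)) (x y : G) :
    f (x * y) = f x + f y := by
  have h : f y - f (x * y) + f x = 0 := DFunLike.congr_fun (LinearMap.mem_ker.1 hf) (x, y)
  linear_combination -h

theorem cupCochain_mem (f g : H1 p G) : cupCochain p f.1 g.1 ∈ Z2 p G := by
  rw [LinearMap.mem_ker]
  ext x
  simp only [cochainD2, cupCochain, LinearMap.coe_mk, AddHom.coe_mk, ContinuousMap.coe_mk,
    map_mul_of_mem_ker p f.2, map_mul_of_mem_ker p g.2, ContinuousMap.zero_apply]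
  ring

variable (G)

/-- The cup product `H¹(G, 𝔽_p) × H¹(G, 𝔽_p) → H²(G, 𝔽_p)`. -/
def cup : H1 p G →ₗ[ZMod p] H1 p G →ₗ[ZMod p] H2 p G :=
  (LinearMap.mk₂ (ZMod p) (fun f g : H1 p G =>
    (⟨cupCochain p f.1 g.1, cupCochain_mem p f g⟩ : Z2 p G))
    (fun f f' g => by ext x; simp [cupCochain]; ring)
    (fun c f g => by ext x; simp [cupCochain]; ring)
    (fun f g g' => by ext x; simp [cupCochain]; ring)
    (fun c f g => by ext x; simp [cupCochain]; ring)).compr₂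
    ((B2 p G).submoduleOf (Z2 p G)).mkQ

/-- `G` is a Demushkin (pro-`p`) group. -/
structure IsDemushkin : Prop where
  isProP : IsProP p G
  finite_H1 : Module.Finite (ZMod p) (H1 p G)
  finrank_H2 : Module.finrank (ZMod p) (H2 p G) = 1
  nondegenerate_cup : (cup p G).Nondegenerate

end Cohomology

/-! ### Unitriangular matrices -/

/-- The group `𝕌_n(R)` of upper-triangular unipotent `n × n` matrices. For `R = ZMod p` it carries
the (discrete) topology induced from the general linear group. -/
def unitriangular (n : ℕ) (R : Type v) [CommRing R] :
    Subgroup (Matrix.GeneralLinearGroup (Fin n) R) where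
  carrier := {A | (∀ i, A.1 i i = 1) ∧ ∀ i j, j < i → A.1 i j = 0}
  one_mem' := ⟨fun i => by simp, fun i j h => by simp [h.ne']⟩
  mul_mem' := by
    rintro A B ⟨hA, hA'⟩ ⟨hB, hB'⟩
    refine ⟨fun i => ?_, fun i j hij => ?_⟩
    · rw [Units.val_mul, Matrix.mul_apply, Finset.sum_eq_single i, hA, hB, one_mul]
      · intro k _ hk
        rcases lt_or_gt_of_ne hk with h | h
        · rw [hA' i k h, zero_mul]
        · rw [hB' k i h, mul_zero]
      · simp
    · rw [Units.val_mul, Matrix.mul_apply]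
      refine Finset.sum_eq_zero fun k _ => ?_
      rcases lt_or_ge k i with h | h
      · rw [hA' i k h, zero_mul]
      · rw [hB' k j (hij.trans_le h), mul_zero]
  inv_mem' := by
    rintro A ⟨hA, hA'⟩
    have hT : (A⁻¹).1.BlockTriangular id := by
      have : Invertible A.1 := A.invertible
      rw [Matrix.coe_units_inv]
      exact Matrix.blockTriangular_inv_of_blockTriangular (fun i j h => hA' i j h)
    refine ⟨fun i => ?_, fun i j h => hT h⟩
    have h1 : (A.1 * (A⁻¹).1) i i = 1 := by
      rw [← Units.val_mul, mul_inv_cancel]; simp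
    rw [Matrix.mul_apply, Finset.sum_eq_single i, hA, one_mul] at h1
    · exact h1
    · intro k _ hk
      rcases lt_or_gt_of_ne hk with h | h
      · rw [hA' i k h, zero_mul]
      · rw [hT h, mul_zero]
    · simp

end

/-! The entries next to the diagonal of a homomorphism from `G` to the unitriangular group of size
`m + 1` are `m` elements of `H¹(G, 𝔽_p)`. The homomorphism is onto exactly when they are linearly
independent: every homomorphism from the unitriangular group to `ℤ/p` is a combination of these
entries, and a proper subgroup of a finite `p`-group is killed by a nonzero such homomorphism
(`unitriangular.surjective_of_linearIndependent`). Since `dim H¹ = d` (`HasRank.finrank_H1`), this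
gives `n ≤ d + 1`, and the converse asks for independent characters that lift to a representation.

By the universal property, lifting can be done factor by factor. On a free factor any characters
lift. On a Demushkin factor it is enough that consecutive cup products vanish
(`IsDemushkin.exists_hom_unitriangular`). The matrix is filled column by column, each column
upwards. The obstruction to an entry is a class in the one-dimensional `H²`. Nondegeneracy makes cup
product with a nonzero `χ i` surjective onto `H²`, so correcting the entry below by a character
removes the obstruction. If one of the characters involved is zero, the entry itself may be taken
zero.

It remains to find independent characters with vanishing consecutive cup products on every Demushkin
factor. A nondegenerate form has a basis with consecutive vectors orthogonal unless it is
alternating in dimension two (`exists_basis_consecutive_ortho`). The bases of the factors combine to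
a basis of `H¹(G)`, ordered so that the two vectors of an exceptional factor are separated by
vectors of other factors (`exists_equiv_sigma_consecutive`). This fails only if all other factors
are trivial; then `G` is itself the exceptional Demushkin group, and two adjacent characters are
needed only in the excluded case. -/

/-! ### Homomorphisms to `ℤ/p` and proper subgroups -/

/-- A proper subgroup of a finite `p`-group is killed by a nontrivial homomorphism to `ℤ/p`. -/
theorem IsPGroup.exists_hom_zmod_ne_one {p : ℕ} [Fact p.Prime] {Q : Type u} [Group Q] [Finite Q]
    (hQ : IsPGroup p Q) {H : Subgroup Q} (hH : H ≠ ⊤) :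
    ∃ f : Q →* Multiplicative (ZMod p), f ≠ 1 ∧ ∀ x ∈ H, f x = 1 := by
  obtain h | ⟨M, hM, hHM⟩ := eq_top_or_exists_le_coatom H
  · exact absurd h hH
  have := hQ.isNilpotent
  have hMn : M.Normal := Subgroup.NormalizerCondition.normal_of_coatom M
    Group.normalizerCondition_of_isNilpotent hM
  have hne : Nontrivial (Q ⧸ M) := QuotientGroup.nontrivial_iff.2 hM.1
  obtain ⟨k, hk, hc⟩ := (hQ.to_quotient M).nontrivial_iff_card.1 hne
  obtain ⟨x, hx⟩ := exists_prime_orderOf_dvd_card' p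
    (hc ▸ dvd_pow_self p hk.ne' : p ∣ Nat.card (Q ⧸ M))
  -- Maximality of `M` forces the order-`p` subgroup generated by `x` to be the whole quotient.
  have hlt : M < (Subgroup.zpowers x).comap (QuotientGroup.mk' M) := by
    refine lt_of_le_of_ne (fun y hy => ?_) fun h => ?_
    · rw [Subgroup.mem_comap, QuotientGroup.mk'_apply, (QuotientGroup.eq_one_iff y).2 hy]
      exact one_mem _
    · obtain ⟨y, rfl⟩ := QuotientGroup.mk_surjective x
      have : y ∈ M := by
        rw [h, Subgroup.mem_comap]
        exact Subgroup.mem_zpowers _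
      rw [(QuotientGroup.eq_one_iff y).2 this, orderOf_one] at hx
      exact (Fact.out : p.Prime).one_lt.ne hx
  have htop : Subgroup.zpowers x = ⊤ := by
    rw [eq_top_iff]
    rintro y -
    obtain ⟨y, rfl⟩ := QuotientGroup.mk_surjective y
    have : y ∈ (Subgroup.zpowers x).comap (QuotientGroup.mk' M) := by
      rw [hM.2 _ hlt]; trivial
    exact this
  have hcard : Nat.card (Q ⧸ M) = p := by
    rw [← hx, ← Nat.card_zpowers, htop, Subgroup.card_top]
  let e : Q ⧸ M ≃* Multiplicative (ZMod p) :=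
    mulEquivOfPrimeCardEq (p := p) hcard (by simp)
  refine ⟨e.toMonoidHom.comp (QuotientGroup.mk' M), fun h => ?_, fun y hy => ?_⟩
  · refine hM.1 (eq_top_iff.2 fun y _ => ?_)
    have := DFunLike.congr_fun h y
    simpa using this
  · simpa using hHM hy

noncomputable section

/-! ### `H¹` of a pro-`p` group and its minimal number of generators. -/

section Rank

variable {p : ℕ} {G : Type u} [Group G] [TopologicalSpace G] [IsTopologicalGroup G]

/-- A continuous additive map as an element of `H¹`. -/
def H1.mk (f : C(G, ZMod p)) (hf : ∀ x y, f (x * y) = f x + f y) : H1 p G :=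
  ⟨f, by
    rw [LinearMap.mem_ker]
    ext x
    simp [cochainD1, hf]⟩

@[simp] theorem H1.mk_apply (f : C(G, ZMod p)) (hf) (x : G) :
    (H1.mk f hf : H1 p G).1 x = f x := rfl

theorem H1.map_mul (χ : H1 p G) (x y : G) : χ.1 (x * y) = χ.1 x + χ.1 y :=
  map_mul_of_mem_ker p χ.2 x y

@[simp] theorem H1.map_one (χ : H1 p G) : χ.1 1 = 0 := by
  simpa using χ.map_mul 1 1

@[simp] theorem H1.map_inv (χ : H1 p G) (x : G) : χ.1 x⁻¹ = -χ.1 x := by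
  have := χ.map_mul x⁻¹ x
  rw [inv_mul_cancel, χ.map_one] at this
  linear_combination -this

/-- The kernel of an element of `H¹`. -/
def H1.ker (χ : H1 p G) : Subgroup G where
  carrier := {x | χ.1 x = 0}
  one_mem' := χ.map_one
  mul_mem' {x y} hx hy := by
    simp only [Set.mem_ofPred_eq] at *
    rw [χ.map_mul, hx, hy, add_zero]
  inv_mem' {x} hx := by
    simp only [Set.mem_ofPred_eq] at *
    rw [χ.map_inv, hx, neg_zero]

theorem H1.mem_ker {χ : H1 p G} {x : G} : x ∈ χ.ker ↔ χ.1 x = 0 := Iff.rfl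

theorem H1.isClosed_ker (χ : H1 p G) : IsClosed (χ.ker : Set G) :=
  isClosed_singleton.preimage χ.1.continuous

theorem H1.eq_zero_of_dense {s : Set G} (hs : (Subgroup.closure s).topologicalClosure = ⊤)
    {χ : H1 p G} (h : ∀ x ∈ s, χ.1 x = 0) : χ = 0 := by
  have h1 : Subgroup.closure s ≤ χ.ker := (Subgroup.closure_le _).2 h
  have h2 := Subgroup.topologicalClosure_minimal _ h1 χ.isClosed_ker
  ext x
  rw [hs] at h2
  exact h2 (Subgroup.mem_top x)

theorem continuous_of_isOpen_le_ker {H : Type v} [Group H] [TopologicalSpace H]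
    [IsTopologicalGroup H] {f : G →* H}
    {N : Subgroup G} (hN : IsOpen (N : Set G)) (h : ∀ x ∈ N, f x = 1) : Continuous f := by
  refine continuous_of_continuousAt_one f ?_
  rw [ContinuousAt, map_one]
  refine Tendsto.congr' (f₁ := fun _ => 1) ?_ tendsto_const_nhds
  filter_upwards [hN.mem_nhds N.one_mem] with x hx using (h x hx).symm

/-- A proper closed subgroup of a pro-`p` group is killed by a nonzero element of `H¹`. -/
theorem IsProP.exists_H1_ne_zero [Fact p.Prime] (hG : IsProP p G) {H : Subgroup G}
    (hc : IsClosed (H : Set G)) (hH : H ≠ ⊤) : ∃ χ : H1 p G, χ ≠ 0 ∧ ∀ x ∈ H, χ.1 x = 0 := by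
  have := hG.compactSpace
  have := hG.totallyDisconnectedSpace
  obtain ⟨x, hx⟩ : ∃ x, x ∉ H := by
    by_contra! h
    exact hH (eq_top_iff.2 fun x _ => h x)
  -- Choose `N` so small that `xN` misses `H`; the image of `H` in the finite quotient then stays
  -- proper.
  obtain ⟨N, hN⟩ := ProfiniteGrp.exist_openNormalSubgroup_sub_open_nhds_of_one
    (U := (fun y => x * y) ⁻¹' (H : Set G)ᶜ) (hc.isOpen_compl.preimage (by fun_prop))
    (by simpa using hx)
  have hNo : IsOpen (N.toSubgroup : Set G) := N.toOpenSubgroup.isOpen'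
  have hfin : Finite (G ⧸ N.toSubgroup) :=
    Subgroup.quotient_finite_of_isOpen _ hNo
  have hne : H.map (QuotientGroup.mk' N.toSubgroup) ≠ ⊤ := by
    intro h
    have : (QuotientGroup.mk' N.toSubgroup x) ∈ H.map (QuotientGroup.mk' N.toSubgroup) := by
      rw [h]; trivial
    obtain ⟨y, hy, hyx⟩ := this
    have h1 : x⁻¹ * y ∈ N.toSubgroup := by
      rw [← QuotientGroup.eq]
      exact hyx.symm
    have := hN h1
    simp only [Set.mem_preimage, mul_inv_cancel_left, Set.mem_compl_iff] at this
    exact this hy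
  obtain ⟨f, hf, hfH⟩ := (hG.isPGroup_quotient N.toSubgroup hNo).exists_hom_zmod_ne_one hne
  let g := f.comp (QuotientGroup.mk' N.toSubgroup)
  have hg : ∀ x ∈ N.toSubgroup, g x = 1 := fun x hx => by
    simp [g, (QuotientGroup.eq_one_iff x).2 hx]
  have hgc : Continuous fun x => (g x).toAdd := by
    have h1 : Continuous g := continuous_of_isOpen_le_ker hNo hg
    exact continuous_toAdd.comp h1
  refine ⟨H1.mk ⟨fun x => (g x).toAdd, hgc⟩ fun x y => by simp, fun h0 => hf ?_, fun y hy => ?_⟩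
  · ext y
    have := DFunLike.congr_fun (congrArg Subtype.val h0) y
    simpa [g, H1.mk] using this
  · have := hfH _ (Subgroup.mem_map_of_mem _ hy)
    simpa [g] using this

/-- The trivial subgroup is closed, so if it were proper it would be killed by a nonzero character.
This discards the factors that contribute nothing to `H¹`. -/
theorem IsProP.subsingleton_of_H1 [Fact p.Prime] (hG : IsProP p G) [Subsingleton (H1 p G)] :
    Subsingleton G := by
  have := hG.compactSpace
  have := hG.totallyDisconnectedSpace
  by_contra h
  have hb : (⊥ : Subgroup G) ≠ ⊤ := fun h' => h (Subgroup.subsingleton_iff.1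
    (subsingleton_of_bot_eq_top h'))
  obtain ⟨χ, hχ, -⟩ := hG.exists_H1_ne_zero (H := ⊥) (by simp) hb
  exact hχ (Subsingleton.elim _ _)

/-- Evaluation of elements of `H¹` at the elements of a finite set. -/
def H1.evalOn {ι : Type v} (s : ι → G) : H1 p G →ₗ[ZMod p] ι → ZMod p where
  toFun χ i := χ.1 (s i)
  map_add' _ _ := rfl
  map_smul' _ _ := rfl

theorem H1.evalOn_injective {s : Finset G}
    (hs : (Subgroup.closure (s : Set G)).topologicalClosure = ⊤) :
    Function.Injective (H1.evalOn (p := p) (Subtype.val : s → G)) := by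
  rw [← LinearMap.ker_eq_bot, LinearMap.ker_eq_bot']
  intro χ h
  exact H1.eq_zero_of_dense hs fun x hx => congrFun h ⟨x, hx⟩

theorem HasRank.finite_H1 [Fact p.Prime] {d : ℕ} (hd : HasRank G d) :
    Module.Finite (ZMod p) (H1 p G) := by
  obtain ⟨⟨s, -, hs⟩, -⟩ := hd
  exact Module.Finite.of_injective _ (H1.evalOn_injective hs)

/-- The Burnside basis theorem. -/
theorem HasRank.finrank_H1 [Fact p.Prime] (hG : IsProP p G) {d : ℕ} (hd : HasRank G d) :
    Module.finrank (ZMod p) (H1 p G) = d := by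
  have hfin := hd.finite_H1 (p := p)
  obtain ⟨⟨s, hsc, hs⟩, hmin⟩ := hd
  refine le_antisymm ?_ ?_
  · have := LinearMap.finrank_le_finrank_of_injective (H1.evalOn_injective (p := p) hs)
    simpa [hsc] using this
  -- Evaluations at group elements have no common zero in `H¹`, so they span its dual. Group
  -- elements whose evaluations form a basis of the dual generate `G` topologically, since no
  -- nonzero character kills all of them.
  · let ev : G → Module.Dual (ZMod p) (H1 p G) := fun x =>
      { toFun := fun χ => χ.1 x, map_add' := fun _ _ => rfl, map_smul' := fun _ _ => rfl }
    have hspan : Submodule.span (ZMod p) (Set.range ev) = ⊤ := by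
      by_contra h
      obtain ⟨χ, hχ0, hχ⟩ : ∃ χ : H1 p G, χ ≠ 0 ∧ ∀ φ ∈ Submodule.span (ZMod p) (Set.range ev), φ χ = 0 := by
        by_contra! h'
        apply h
        rw [← Subspace.dualCoannihilator_dualAnnihilator_eq
          (W := Submodule.span (ZMod p) (Set.range ev))]
        rw [← Submodule.dualAnnihilator_bot]
        congr 1
        rw [eq_bot_iff]
        intro χ hχ
        by_contra hne
        obtain ⟨φ, hφ, hne'⟩ := h' χ hne
        exact hne' ((Submodule.mem_dualCoannihilator _).1 hχ φ hφ)
      apply hχ0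
      ext x
      exact hχ _ (Submodule.subset_span ⟨x, rfl⟩)
    obtain ⟨t, ht, htspan, hli⟩ := exists_linearIndependent (ZMod p) (Set.range ev)
    have htf : t.Finite := hli.setFinite
    have hcard : Nat.card t = Module.finrank (ZMod p) (H1 p G) := by
      have := htf.fintype
      rw [← Subspace.dual_finrank_eq (K := ZMod p) (V := H1 p G), Nat.card_eq_fintype_card]
      let b := Module.Basis.mk hli (by rw [Subtype.range_coe, htspan, hspan])
      exact (Module.finrank_eq_card_basis b).symm
    choose g hg using fun φ : t => ht φ.2
    have := htf.fintype
    classical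
    have hgi : Function.Injective g := fun a b hab => by
      apply Subtype.ext; rw [← hg a, ← hg b, hab]
    rw [← hcard]
    refine hmin ⟨Finset.univ.image g, ?_, ?_⟩
    · rw [Finset.card_image_of_injective _ hgi, Finset.card_univ, Nat.card_eq_fintype_card]
    · by_contra hne
      obtain ⟨χ, hχ0, hχ⟩ := hG.exists_H1_ne_zero (Subgroup.isClosed_topologicalClosure _) hne
      apply hχ0
      have h1 : ∀ φ ∈ Submodule.span (ZMod p) t, φ χ = 0 := fun φ hφ => by
        induction hφ using Submodule.span_induction with
        | mem φ h =>
          rw [show φ = ev (g ⟨φ, h⟩) from (hg ⟨φ, h⟩).symm]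
          refine hχ _ (Subgroup.le_topologicalClosure _ (Subgroup.subset_closure ?_))
          simp
        | zero => rfl
        | add a b _ _ ha hb => rw [LinearMap.add_apply, ha, hb, add_zero]
        | smul c a _ ha => rw [LinearMap.smul_apply, ha, smul_zero]
      ext x
      refine h1 (ev x) ?_
      rw [htspan]
      exact Submodule.subset_span ⟨x, rfl⟩

end Rank

end

/-! ### The group of unitriangular matrices -/

noncomputable section

namespace unitriangular

section Ring

variable {n : ℕ} {R : Type v} [CommRing R]

/-- A unitriangular matrix as an element of `unitriangular n R`. -/
def of (M : Matrix (Fin n) (Fin n) R) (h1 : ∀ i, M i i = 1) (h0 : ∀ i j, j < i → M i j = 0) :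
    unitriangular n R :=
  ⟨Matrix.GeneralLinearGroup.mk'' M (by
    rw [Matrix.det_of_isUpperTriangular (fun i j h => h0 i j h)]
    simp [h1]), h1, h0⟩

@[simp] theorem of_val (M : Matrix (Fin n) (Fin n) R) (h1) (h0) :
    ((of M h1 h0).1.1 : Matrix (Fin n) (Fin n) R) = M := rfl

theorem ext' {A B : unitriangular n R} (h : A.1.1 = B.1.1) : A = B :=
  Subtype.ext (Units.ext h)

@[simp] theorem mul_val (A B : unitriangular n R) : (A * B).1.1 = A.1.1 * B.1.1 := rfl

@[simp] theorem one_val : (1 : unitriangular n R).1.1 = 1 := rfl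

theorem diag (A : unitriangular n R) (i : Fin n) : A.1.1 i i = 1 := A.2.1 i

theorem lower (A : unitriangular n R) {i j : Fin n} (h : j < i) : A.1.1 i j = 0 := A.2.2 i j h

/-- The elementary unitriangular matrix `1 + c E_{ij}`. -/
def elem (i j : Fin n) (h : i < j) (c : R) : unitriangular n R :=
  of (Matrix.transvection i j c)
    (fun k => by
      simp only [Matrix.transvection, Matrix.add_apply, Matrix.one_apply_eq, Matrix.single_apply]
      rw [if_neg, add_zero]
      rintro ⟨rfl, rfl⟩
      exact h.ne rfl)
    (fun k l hkl => by
      simp only [Matrix.transvection, Matrix.add_apply, Matrix.one_apply_ne hkl.ne',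
        Matrix.single_apply]
      rw [if_neg, add_zero]
      rintro ⟨rfl, rfl⟩
      exact h.not_gt hkl)

theorem elem_val (i j : Fin n) (h : i < j) (c : R) :
    (elem i j h c).1.1 = Matrix.transvection i j c := rfl

theorem elem_add (i j : Fin n) (h : i < j) (c d : R) :
    elem i j h (c + d) = elem i j h c * elem i j h d := by
  apply ext'
  rw [mul_val, elem_val, elem_val, elem_val, Matrix.transvection_mul_transvection_same _ _ h.ne]

theorem elem_zero (i j : Fin n) (h : i < j) : elem i j h (0 : R) = 1 := by
  apply ext'
  rw [elem_val, Matrix.transvection_zero, one_val]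

/-- The commutator relation, written without inverses: after mapping to a commutative group,
everything but the image of the `(i, j)` factor cancels. -/
theorem elem_mul_elem {i k j : Fin n} (hik : i < k) (hkj : k < j) (c : R) :
    elem i k hik c * elem k j hkj 1 =
      elem i j (hik.trans hkj) c * elem k j hkj 1 * elem i k hik c := by
  apply ext'
  simp only [mul_val, elem_val, Matrix.transvection, mul_add, add_mul, mul_one, one_mul,
    Matrix.single_mul_single_same]
  rw [Matrix.single_mul_single_of_ne _ _ _ _ hkj.ne', Matrix.single_mul_single_of_ne _ _ _ _
    (hik.trans hkj).ne', Matrix.single_mul_single_of_ne _ _ _ _ (hik.trans hkj).ne']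
  simp only [add_zero, zero_mul]
  abel

/-- A homomorphism to a commutative group which kills the elementary matrices next to the diagonal
is trivial. -/
theorem hom_eq_one {m : ℕ} {C : Type u} [CommGroup C] (f : unitriangular (m + 1) R →* C)
    (hf : ∀ (k : Fin m) (c : R), f (elem k.castSucc k.succ k.castSucc_lt_succ c) = 1) : f = 1 := by
  have h1 : ∀ (N : ℕ) (i j : Fin (m + 1)) (h : i < j) (c : R), (j : ℕ) = i + N →
      f (elem i j h c) = 1 := by
    intro N
    induction N using Nat.strong_induction_on with
    | _ N ih =>
      intro i j h c hN
      have him : (i : ℕ) < m := by omega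
      obtain rfl | hN2 : N = 1 ∨ 2 ≤ N := by omega
      · have hi : i = (⟨i, him⟩ : Fin m).castSucc := rfl
        have hj : j = (⟨i, him⟩ : Fin m).succ := Fin.ext (by simp [hN])
        have := hf ⟨i, him⟩ c
        convert this
      · let k : Fin (m + 1) := ⟨i + 1, by omega⟩
        have hik : i < k := Fin.lt_def.2 (by simp [k])
        have hkj : k < j := Fin.lt_def.2 (by simp only [k]; omega)
        have := congrArg f (elem_mul_elem hik hkj c)
        rw [map_mul, map_mul, map_mul, mul_comm (f (elem i j _ c)), mul_assoc,
          mul_comm (f (elem i j _ c)), ← mul_assoc, mul_comm (f (elem k j _ 1)),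
          left_eq_mul] at this
        exact this
  have h2 : ∀ (i j : Fin (m + 1)) (h : i < j) (c : R), f (elem i j h c) = 1 :=
    fun i j h c => h1 (j - i) i j h c (by have := Fin.lt_def.1 h; omega)
  classical
  suffices H : ∀ (N : ℕ) (A : unitriangular (m + 1) R),
      (Finset.univ.filter fun x : Fin (m + 1) × Fin (m + 1) => x.1 < x.2 ∧ A.1.1 x.1 x.2 ≠ 0).card
        = N → f A = 1 by
    ext A
    exact H _ A rfl
  intro N
  induction N using Nat.strong_induction_on with
  | _ N ih =>
    intro A hA
    by_cases hone : A = 1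
    · rw [hone, map_one]
    have hex : ∃ i j, i < j ∧ A.1.1 i j ≠ 0 := by
      by_contra! h
      apply hone
      apply ext'
      ext i j
      rcases lt_trichotomy i j with hij | rfl | hij
      · rw [h i j hij, one_val, Matrix.one_apply_ne hij.ne]
      · rw [diag A, one_val, Matrix.one_apply_eq]
      · rw [lower A hij, one_val, Matrix.one_apply_ne hij.ne']
    -- Take the lowest row with a nonzero entry above the diagonal. Row `j` lies below it and is a
    -- unit vector, so subtracting a multiple of it clears the entry `(i, j)` and changes nothing
    -- else.
    obtain ⟨i, hi, hmax⟩ := Set.Finite.exists_maximal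
      (Set.toFinite {i | ∃ j, i < j ∧ A.1.1 i j ≠ 0}) hex
    obtain ⟨j, hij, hne⟩ := hi
    have hrow : ∀ l, A.1.1 j l = if j = l then 1 else 0 := by
      intro l
      rcases lt_trichotomy j l with h | rfl | h
      · rw [if_neg h.ne]
        by_contra h0
        exact absurd (hmax ⟨l, h, h0⟩ hij.le) hij.not_ge
      · rw [diag A, if_pos rfl]
      · rw [lower A h, if_neg h.ne']
    have key : ∀ k l, (elem i j hij (-A.1.1 i j) * A).1.1 k l =
        if k = i ∧ l = j then 0 else A.1.1 k l := by
      intro k l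
      rw [mul_val, elem_val]
      by_cases hk : k = i
      · subst hk
        rw [Matrix.transvection_mul_apply_same, hrow]
        by_cases hl : l = j
        · subst hl; simp
        · rw [if_neg (Ne.symm hl), if_neg (fun h => hl h.2)]; ring
      · rw [Matrix.transvection_mul_apply_of_ne _ _ _ _ hk, if_neg (fun h => hk h.1)]
    have hlt : (Finset.univ.filter fun x : Fin (m + 1) × Fin (m + 1) =>
        x.1 < x.2 ∧ (elem i j hij (-A.1.1 i j) * A).1.1 x.1 x.2 ≠ 0).card < N := by
      rw [← hA]
      refine Finset.card_lt_card (Finset.ssubset_iff_of_subset ?_ |>.2 ⟨(i, j), ?_, ?_⟩)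
      · intro x hx
        simp only [Finset.mem_filter, Finset.mem_univ, true_and, key] at hx ⊢
        refine ⟨hx.1, fun h => hx.2 ?_⟩
        rw [h, ite_self]
      · simpa using ⟨hij, hne⟩
      · simp only [Finset.mem_filter, Finset.mem_univ, true_and, key]
        simp
    have := ih _ hlt _ rfl
    rwa [map_mul, h2, one_mul] at this

/-- The homomorphism given by the entries next to the diagonal. -/
def superdiag {m : ℕ} (k : Fin m) : unitriangular (m + 1) R →* Multiplicative R :=
  MonoidHom.mk' (fun A => Multiplicative.ofAdd (A.1.1 k.castSucc k.succ)) fun A B => by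
    rw [← ofAdd_add, mul_val, Matrix.mul_apply]
    congr 1
    have hne : k.castSucc ≠ k.succ := k.castSucc_lt_succ.ne
    rw [Finset.sum_eq_add_of_mem k.castSucc k.succ (Finset.mem_univ _) (Finset.mem_univ _) hne]
    · rw [diag A, diag B]; ring
    · rintro l - ⟨h1, h2⟩
      rcases lt_or_gt_of_ne h1 with h | h
      · rw [lower A h, zero_mul]
      · have : k.succ < l := by
          refine lt_of_le_of_ne ?_ (Ne.symm h2)
          rw [Fin.le_def]; rw [Fin.lt_def] at h
          simp only [Fin.val_succ, Fin.val_castSucc] at *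
          omega
        rw [lower B this, mul_zero]

theorem superdiag_apply {m : ℕ} (k : Fin m) (A : unitriangular (m + 1) R) :
    (superdiag k A).toAdd = A.1.1 k.castSucc k.succ := rfl

theorem superdiag_elem {m : ℕ} (k l : Fin m) (c : R) :
    (elem k.castSucc k.succ k.castSucc_lt_succ c).1.1 l.castSucc l.succ = if l = k then c else 0 := by
  rw [elem_val, Matrix.transvection, Matrix.add_apply, Matrix.one_apply_ne l.castSucc_lt_succ.ne,
    Matrix.single_apply, zero_add]
  congr 1
  simp [eq_comm]

end Ring

/-! ### Unitriangular groups over `𝔽_p`: topology, order and maps to `ℤ/p`. -/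

section ZMod

variable {p n : ℕ}

instance : DiscreteTopology (unitriangular n (ZMod p)) := by
  have : DiscreteTopology (Matrix (Fin n) (Fin n) (ZMod p)) :=
    inferInstanceAs (DiscreteTopology (Fin n → Fin n → ZMod p))
  exact DiscreteTopology.of_continuous_injective (f := fun A : unitriangular n (ZMod p) => A.1.1)
    (Units.continuous_val.comp continuous_subtype_val) fun _ _ h => ext' h

theorem continuous_iff_entries {X : Type u} [TopologicalSpace X] {f : X → unitriangular n (ZMod p)} :
    Continuous f ↔ ∀ i j, Continuous fun x => (f x).1.1 i j := by
  have : DiscreteTopology (Matrix (Fin n) (Fin n) (ZMod p)) :=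
    inferInstanceAs (DiscreteTopology (Fin n → Fin n → ZMod p))
  have hc : Continuous fun A : unitriangular n (ZMod p) => A.1.1 := continuous_of_discreteTopology
  refine ⟨fun h i j => ?_, fun h => ?_⟩
  · exact (continuous_apply j).comp ((continuous_apply i).comp (hc.comp h))
  · have h1 : Continuous fun x => (f x).1.1 := continuous_pi fun i => continuous_pi fun j => h i j
    rw [continuous_discrete_rng]
    intro b
    have : f ⁻¹' {b} = (fun x => (f x).1.1) ⁻¹' {b.1.1} := by
      ext x
      exact ⟨fun h => congrArg (fun A : unitriangular n (ZMod p) => A.1.1) h, fun h => ext' h⟩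
    rw [this]
    exact (isOpen_discrete _).preimage h1

variable [Fact p.Prime]

instance : Finite (unitriangular n (ZMod p)) :=
  Finite.of_injective (fun A : unitriangular n (ZMod p) => A.1.1) fun _ _ h => ext' h

theorem isPGroup : IsPGroup p (unitriangular n (ZMod p)) := by
  rw [isPGroup_iff_pow_pow_eq_one]
  intro A
  have hp : p.Prime := Fact.out
  refine ⟨n, ?_⟩
  have hchar : A.1.1.charpoly = (Polynomial.X - 1) ^ n := by
    rw [Matrix.charpoly_of_isUpperTriangular A.1.1 (fun i j h => lower A h)]
    simp [diag A]
  have hnil : (A.1.1 - 1) ^ n = 0 := by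
    have := Matrix.aeval_self_charpoly A.1.1
    rw [hchar] at this
    simpa using this
  apply ext'
  have hpow : ∀ k : ℕ, (A ^ k).1.1 = A.1.1 ^ k := fun k => by simp
  rw [hpow, one_val]
  rcases Nat.eq_zero_or_pos n with rfl | hn
  · exact Subsingleton.elim _ _
  have : Nonempty (Fin n) := ⟨⟨0, hn⟩⟩
  -- In characteristic `p` the Frobenius identity turns nilpotency of `A - 1` into `A ^ p ^ n = 1`,
  -- because `n < p ^ n`.
  have h2 : (A.1.1 - 1) ^ p ^ n = A.1.1 ^ p ^ n - 1 ^ p ^ n :=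
    sub_pow_char_pow_of_commute _ _ (Commute.one_right _)
  rw [one_pow] at h2
  rw [← sub_eq_zero, ← h2, ← Nat.sub_add_cancel (Nat.lt_pow_self hp.one_lt (n := n)).le, pow_add,
    hnil, mul_zero]

theorem hom_zmod_apply {m : ℕ} (f : unitriangular (m + 1) (ZMod p) →* Multiplicative (ZMod p)) :
    ∃ c : Fin m → ZMod p, ∀ A, (f A).toAdd = ∑ k, c k * A.1.1 k.castSucc k.succ := by
  let c : Fin m → ZMod p := fun k => (f (elem k.castSucc k.succ k.castSucc_lt_succ 1)).toAdd
  have hc : ∀ k a, (f (elem k.castSucc k.succ k.castSucc_lt_succ a)).toAdd = c k * a := by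
    intro k a
    let g : ZMod p →+ ZMod p :=
      { toFun := fun a => (f (elem k.castSucc k.succ k.castSucc_lt_succ a)).toAdd
        map_zero' := by rw [elem_zero, map_one]; rfl
        map_add' := fun a b => by rw [elem_add, map_mul]; rfl }
    have := (g.toZModLinearMap p).map_smul a 1
    simp only [smul_eq_mul, mul_one] at this
    rw [mul_comm]
    exact this
  refine ⟨c, fun A => ?_⟩
  let g : unitriangular (m + 1) (ZMod p) →* Multiplicative (ZMod p) :=
    MonoidHom.mk' (fun A => Multiplicative.ofAdd (∑ k, c k * A.1.1 k.castSucc k.succ)) fun A B => by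
      rw [← ofAdd_add, ← Finset.sum_add_distrib]
      congr 1
      refine Finset.sum_congr rfl fun k _ => ?_
      rw [← superdiag_apply, map_mul, toAdd_mul, superdiag_apply, superdiag_apply, mul_add]
  have hg : ∀ A, (g A).toAdd = ∑ k, c k * A.1.1 k.castSucc k.succ := fun _ => rfl
  have h1 : f / g = 1 := by
    refine hom_eq_one _ fun k a => ?_
    rw [MonoidHom.div_apply]
    apply Multiplicative.toAdd.injective
    rw [toAdd_div, hc, hg]
    simp [superdiag_elem]
  have := DFunLike.congr_fun (div_eq_one.1 h1) A
  rw [this, hg]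

/-- A homomorphism to the unitriangular group is onto if its entries next to the diagonal are
linearly independent. -/
theorem surjective_of_superdiag {m : ℕ} {G : Type u} [Group G]
    (φ : G →* unitriangular (m + 1) (ZMod p))
    (h : ∀ c : Fin m → ZMod p, (∀ x, ∑ k, c k * (φ x).1.1 k.castSucc k.succ = 0) → c = 0) :
    Function.Surjective φ := by
  rw [← MonoidHom.range_eq_top]
  by_contra hne
  obtain ⟨f, hf, hfr⟩ := (isPGroup (p := p)).exists_hom_zmod_ne_one hne
  obtain ⟨c, hc⟩ := hom_zmod_apply f
  have := h c fun x => by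
    rw [← hc, hfr _ ⟨x, rfl⟩, toAdd_one]
  apply hf
  ext A
  rw [hc, this]
  simp

end ZMod

end unitriangular

end

noncomputable section

/-! ### Prescribing the entries next to the diagonal -/

section Massey

variable {p : ℕ} {G : Type u} [Group G] [TopologicalSpace G] [IsTopologicalGroup G]

/-- The row `i` and the column `j` of upper triangular functions form a defining system for the
entry `(i, j)`. -/
def SatisfiesAt (a : ℕ → ℕ → C(G, ZMod p)) (i j : ℕ) : Prop :=
  ∀ g h, a i j (g * h) = a i j g + a i j h + ∑ k ∈ Finset.Ioo i j, a i k g * a k j h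

/-- The `2`-cochain `∑ a_{ik} ∪ a_{kj}`. -/
def masseyCochain (a : ℕ → ℕ → C(G, ZMod p)) (i j : ℕ) : C(G × G, ZMod p) :=
  ∑ k ∈ Finset.Ioo i j, cupCochain p (a i k) (a k j)

omit [Group G] [IsTopologicalGroup G] in
theorem masseyCochain_apply (a : ℕ → ℕ → C(G, ZMod p)) (i j : ℕ) (x : G × G) :
    masseyCochain a i j x = ∑ k ∈ Finset.Ioo i j, a i k x.1 * a k j x.2 := by
  simp [masseyCochain, cupCochain]

/-- This is associativity of matrix multiplication: expanding both products gives the same sum over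
`i < y < x < j`, and the remaining terms cancel. Only the relations in row `i` and column `j`
strictly between enter. -/
theorem masseyCochain_mem_Z2 {a : ℕ → ℕ → C(G, ZMod p)} {i j : ℕ}
    (hrow : ∀ k, i < k → k < j → SatisfiesAt a i k) (hcol : ∀ k, i < k → k < j → SatisfiesAt a k j) :
    masseyCochain a i j ∈ Z2 p G := by
  rw [LinearMap.mem_ker]
  ext ⟨g, h, k⟩
  simp only [cochainD2, LinearMap.coe_mk, AddHom.coe_mk, ContinuousMap.coe_mk,
    masseyCochain_apply, ContinuousMap.zero_apply]
  have e1 : ∑ x ∈ Finset.Ioo i j, a i x (g * h) * a x j k =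
      ∑ x ∈ Finset.Ioo i j, (a i x g * a x j k + a i x h * a x j k +
        ∑ y ∈ Finset.Ioo i x, a i y g * a y x h * a x j k) := by
    refine Finset.sum_congr rfl fun x hx => ?_
    rw [Finset.mem_Ioo] at hx
    rw [hrow x hx.1 hx.2 g h, add_mul, add_mul, Finset.sum_mul]
  have e2 : ∑ x ∈ Finset.Ioo i j, a i x g * a x j (h * k) =
      ∑ x ∈ Finset.Ioo i j, (a i x g * a x j h + a i x g * a x j k +
        ∑ y ∈ Finset.Ioo x j, a i x g * a x y h * a y j k) := by
    refine Finset.sum_congr rfl fun x hx => ?_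
    rw [Finset.mem_Ioo] at hx
    rw [hcol x hx.1 hx.2 h k, mul_add, mul_add, Finset.mul_sum]
    simp only [mul_assoc]
  have e3 : ∑ x ∈ Finset.Ioo i j, ∑ y ∈ Finset.Ioo i x, a i y g * a y x h * a x j k =
      ∑ x ∈ Finset.Ioo i j, ∑ y ∈ Finset.Ioo x j, a i x g * a x y h * a y j k := by
    rw [Finset.sum_comm' (t' := Finset.Ioo i j) (s' := fun y => Finset.Ioo y j)]
    intro x y
    simp only [Finset.mem_Ioo]
    omega
  rw [e1, e2]
  simp only [Finset.sum_add_distrib]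
  rw [e3]
  ring

/-- Every class in `H²` of a Demushkin group is a cup product with a given nonzero `χ`. -/
theorem IsDemushkin.exists_cup_eq [Fact p.Prime] (hG : IsDemushkin p G) {χ : H1 p G} (hχ : χ ≠ 0)
    (z : H2 p G) : ∃ ψ : H1 p G, cup p G χ ψ = z := by
  obtain ⟨ψ, hψ⟩ : ∃ ψ, cup p G χ ψ ≠ 0 := by
    by_contra! h
    exact hχ (hG.nondegenerate_cup.1 χ h)
  obtain ⟨c, hc⟩ := exists_smul_eq_of_finrank_eq_one hG.finrank_H2 hψ z
  exact ⟨c • ψ, by rw [map_smul, hc]⟩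

theorem H2.mk_eq_zero_iff {z : Z2 p G} :
    (Submodule.Quotient.mk z : H2 p G) = 0 ↔ ∃ f : C(G, ZMod p), cochainD1 p G f = z.1 := by
  rw [Submodule.Quotient.mk_eq_zero]
  exact Iff.rfl

theorem cup_apply (χ ψ : H1 p G) : cup p G χ ψ =
    Submodule.Quotient.mk ⟨cupCochain p χ.1 ψ.1, cupCochain_mem p χ ψ⟩ := rfl

/-- Adding one entry on top of a partial column. -/
theorem IsDemushkin.exists_column_step [Fact p.Prime] (hG : IsDemushkin p G) (χ : ℕ → H1 p G)
    (hχ : ∀ k, cup p G (χ k) (χ (k + 1)) = 0) {j : ℕ} {a : ℕ → ℕ → C(G, ZMod p)}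
    (ha1 : ∀ i, i + 1 ≤ j → a i (i + 1) = (χ i).1)
    (ha : ∀ i k, i < k → k < j → SatisfiesAt a i k)
    (ha0 : ∀ i k l, i ≤ l → l < k → k < j → χ l = 0 → a i k = 0)
    {i : ℕ} (hij : i + 1 < j)
    (hc : ∀ k, i < k → k < j → SatisfiesAt a k j)
    (hc0 : ∀ k l, i < k → k ≤ l → l < j → χ l = 0 → a k j = 0) :
    ∃ c : ℕ → C(G, ZMod p), c (j - 1) = (χ (j - 1)).1 ∧
      (∀ k, i ≤ k → k < j → ∀ g h, c k (g * h) = c k g + c k h +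
        ∑ l ∈ Finset.Ioo k j, a k l g * c l h) ∧
      (∀ k l, i ≤ k → k ≤ l → l < j → χ l = 0 → c k = 0) := by
  have hj1 : a (j - 1) j = (χ (j - 1)).1 := by
    have := ha1 (j - 1) (by omega)
    rwa [Nat.sub_add_cancel (by omega)] at this
  by_cases hz : ∃ l, i ≤ l ∧ l < j ∧ χ l = 0
  · obtain ⟨l, hil, hlj, hl⟩ := hz
    -- Entries whose index interval contains a zero character vanish. In each product `a i x * a x
    -- j` one of the two intervals contains `l`, so the zero entry satisfies its equation.
    refine ⟨fun k => if k = i then 0 else a k j, ?_, ?_, ?_⟩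
    · simp only
      rw [if_neg (by omega), hj1]
    · intro k hik hkj g h
      simp only
      rcases hik.eq_or_lt with rfl | hik
      · rw [if_pos rfl, Finset.sum_eq_zero]
        · simp
        · intro x hx
          rw [Finset.mem_Ioo] at hx
          rw [if_neg (by omega)]
          rcases lt_or_ge l x with h1 | h1
          · rw [ha0 i x l hil h1 hx.2 hl]; simp
          · rw [hc0 x l hx.1 h1 hlj hl]; simp
      · rw [if_neg (by omega), hc k hik hkj g h]
        congr 1
        refine Finset.sum_congr rfl fun x hx => ?_
        rw [Finset.mem_Ioo] at hx
        rw [if_neg (by omega)]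
    · intro k l hik hkl hlj hl
      simp only
      split_ifs with h
      · rfl
      · exact hc0 k l (by omega) hkl hlj hl
  push Not at hz
  -- When `i + 1 = j - 1`, the entry below is the prescribed `χ (j - 1)` and must not be changed,
  -- but there the obstruction is the cup product assumed to vanish. Otherwise `χ i ≠ 0` and some `χ
  -- i ∪ ψ` cancels the obstruction.
  have hcoc : ∃ ψ : H1 p G, (i + 1 = j - 1 → ψ = 0) ∧ ∃ f : C(G, ZMod p),
      cochainD1 p G f = masseyCochain a i j + cupCochain p (χ i).1 ψ.1 := by
    have hm := masseyCochain_mem_Z2 (fun k h1 h2 => ha i k h1 h2) hc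
    by_cases h1 : i + 1 = j - 1
    · refine ⟨0, fun _ => rfl, ?_⟩
      have h2 := hχ i
      rw [cup_apply, H2.mk_eq_zero_iff] at h2
      obtain ⟨f, hf⟩ := h2
      refine ⟨f, ?_⟩
      have hIoo : Finset.Ioo i j = {i + 1} := by
        ext x; simp only [Finset.mem_Ioo, Finset.mem_singleton]; omega
      rw [hf, masseyCochain, hIoo, Finset.sum_singleton, ha1 i (by omega), h1, hj1]
      ext x
      simp [cupCochain]
    · obtain ⟨ψ, hψ⟩ := hG.exists_cup_eq (hz i le_rfl (by omega))
        (-(Submodule.Quotient.mk ⟨_, hm⟩))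
      refine ⟨ψ, fun h => absurd h h1, ?_⟩
      rw [cup_apply, eq_neg_iff_add_eq_zero, ← Submodule.Quotient.mk_add, H2.mk_eq_zero_iff] at hψ
      obtain ⟨f, hf⟩ := hψ
      exact ⟨f, by rw [hf, add_comm]; rfl⟩
  obtain ⟨ψ, hψ, f, hf⟩ := hcoc
  -- Adding the homomorphism `ψ` to the entry `(i + 1, j)` preserves its own equation, and no lower
  -- row of the column involves it. The sign of `f` comes from the sign of the product term in
  -- `cochainD1`.
  refine ⟨fun k => if k = i then -f else if k = i + 1 then a k j + ψ.1 else a k j, ?_, ?_, ?_⟩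
  · simp only
    rw [if_neg (by omega)]
    split_ifs with h
    · rw [hψ h.symm, hj1]; simp
    · exact hj1
  · intro k hik hkj g h
    simp only
    rcases hik.eq_or_lt with rfl | hik
    · have h1 := DFunLike.congr_fun hf (g, h)
      simp only [cochainD1, LinearMap.coe_mk, AddHom.coe_mk, ContinuousMap.coe_mk,
        ContinuousMap.add_apply, masseyCochain_apply, cupCochain] at h1
      have h2 : ∑ l ∈ Finset.Ioo i j, a i l g *
          (if l = i then -f else if l = i + 1 then a l j + ψ.1 else a l j) h =
          ∑ l ∈ Finset.Ioo i j, a i l g * a l j h + (χ i).1 g * ψ.1 h := by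
        have : ∀ l ∈ Finset.Ioo i j, a i l g *
          (if l = i then -f else if l = i + 1 then a l j + ψ.1 else a l j) h =
            a i l g * a l j h + (if l = i + 1 then (χ i).1 g * ψ.1 h else 0) := by
          intro l hl
          rw [Finset.mem_Ioo] at hl
          rw [if_neg (by omega)]
          split_ifs with h3
          · subst h3
            rw [ContinuousMap.add_apply, mul_add, ha1 i (by omega)]
          · rw [add_zero]
        rw [Finset.sum_congr rfl this, Finset.sum_add_distrib, Finset.sum_ite_eq', if_pos]
        rw [Finset.mem_Ioo]; omega
      rw [h2, if_pos rfl, ← h1]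
      simp only [ContinuousMap.neg_apply]
      ring
    · rw [if_neg (by omega)]
      have h2 : ∑ l ∈ Finset.Ioo k j, a k l g *
          (if l = i then -f else if l = i + 1 then a l j + ψ.1 else a l j) h =
          ∑ l ∈ Finset.Ioo k j, a k l g * a l j h := by
        refine Finset.sum_congr rfl fun l hl => ?_
        rw [Finset.mem_Ioo] at hl
        rw [if_neg (by omega), if_neg (by omega)]
      rw [h2]
      split_ifs with h3
      · simp only [ContinuousMap.add_apply]
        rw [hc k hik hkj g h, ψ.map_mul]
        ring
      · exact hc k hik hkj g h
  · intro k l hik hkl hlj hl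
    exact absurd hl (hz l (hik.trans hkl) hlj)

/-- Filling in a column. -/
theorem IsDemushkin.exists_column [Fact p.Prime] (hG : IsDemushkin p G) (χ : ℕ → H1 p G)
    (hχ : ∀ k, cup p G (χ k) (χ (k + 1)) = 0) {j : ℕ} {a : ℕ → ℕ → C(G, ZMod p)}
    (ha1 : ∀ i, i + 1 < j → a i (i + 1) = (χ i).1)
    (ha : ∀ i k, i < k → k < j → SatisfiesAt a i k)
    (ha0 : ∀ i k l, i ≤ l → l < k → k < j → χ l = 0 → a i k = 0) (hj : 0 < j) (m : ℕ) (hm : m < j) :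
    ∃ c : ℕ → C(G, ZMod p), c (j - 1) = (χ (j - 1)).1 ∧
      (∀ k, j - 1 - m ≤ k → k < j → ∀ g h, c k (g * h) = c k g + c k h +
        ∑ l ∈ Finset.Ioo k j, a k l g * c l h) ∧
      (∀ k l, j - 1 - m ≤ k → k ≤ l → l < j → χ l = 0 → c k = 0) := by
  induction m with
  | zero =>
    refine ⟨fun _ => (χ (j - 1)).1, rfl, ?_, ?_⟩
    · intro k h1 h2 g h
      have : Finset.Ioo k j = ∅ := Finset.eq_empty_of_forall_notMem fun x hx => by
        rw [Finset.mem_Ioo] at hx; omega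
      rw [this, Finset.sum_empty, add_zero]
      exact (χ (j - 1)).map_mul g h
    · intro k l h1 h2 h3 h4
      have : l = j - 1 := by omega
      rw [← this, h4]; rfl
  | succ m ih =>
    obtain ⟨c, hc1, hc, hc0⟩ := ih (by omega)
    -- The partial column is glued to the finished ones to form the array that the one-step
    -- extension expects.
    let a' : ℕ → ℕ → C(G, ZMod p) := fun i k => if k = j then c i else a i k
    have haj : ∀ i, a' i j = c i := fun i => if_pos rfl
    have hak : ∀ i k, k < j → a' i k = a i k := fun i k h => if_neg h.ne
    obtain ⟨c', h1, h2, h3⟩ := hG.exists_column_step χ hχ (j := j) (a := a')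
      (i := j - 1 - (m + 1))
      (fun i hi => by
        rcases hi.eq_or_lt with h | hi
        · rw [h, haj, show i = j - 1 by omega]; exact hc1
        · rw [hak _ _ hi, ha1 i hi])
      (fun i k hik hkj g h => by
        rw [hak _ _ hkj, ha i k hik hkj g h]
        congr 1
        refine Finset.sum_congr rfl fun l hl => ?_
        rw [Finset.mem_Ioo] at hl
        rw [hak _ _ hkj, hak _ _ (hl.2.trans hkj)])
      (fun i k l h1 h2 h3 h4 => by rw [hak _ _ h3, ha0 i k l h1 h2 h3 h4])
      (by omega)
      (fun k h1 h2 g h => by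
        rw [haj, hc k (by omega) h2 g h]
        congr 1
        refine Finset.sum_congr rfl fun l hl => ?_
        rw [Finset.mem_Ioo] at hl
        rw [haj, hak _ _ hl.2])
      (fun k l h1 h2 h3 h4 => by
        rw [haj]
        exact hc0 k l (by omega) h2 h3 h4)
    refine ⟨c', h1, fun k hk hkj g h => ?_, h3⟩
    rw [h2 k hk hkj g h]
    congr 1
    refine Finset.sum_congr rfl fun l hl => ?_
    rw [Finset.mem_Ioo] at hl
    rw [hak _ _ hl.2]

/-- Columns are added one at a time. The last clause, vanishing of entries across a zero character,
is carried along because cup product with a zero character cannot correct any obstruction. -/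
theorem IsDemushkin.exists_definingSystem [Fact p.Prime] (hG : IsDemushkin p G) (χ : ℕ → H1 p G)
    (hχ : ∀ k, cup p G (χ k) (χ (k + 1)) = 0) (j : ℕ) :
    ∃ a : ℕ → ℕ → C(G, ZMod p), (∀ i, i + 1 < j → a i (i + 1) = (χ i).1) ∧
      (∀ i k, i < k → k < j → SatisfiesAt a i k) ∧
      (∀ i k l, i ≤ l → l < k → k < j → χ l = 0 → a i k = 0) := by
  induction j with
  | zero => exact ⟨0, by omega, by omega, by omega⟩
  | succ j ih =>
    obtain ⟨a, ha1, ha, ha0⟩ := ih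
    rcases Nat.eq_zero_or_pos j with rfl | hj
    · exact ⟨0, by omega, by omega, by omega⟩
    obtain ⟨c, hc1, hc, hc0⟩ := hG.exists_column χ hχ ha1 ha ha0 hj (j - 1) (by omega)
    rw [Nat.sub_self] at hc hc0
    let a' : ℕ → ℕ → C(G, ZMod p) := fun i k => if k = j then c i else a i k
    have haj : ∀ i, a' i j = c i := fun i => if_pos rfl
    have hak : ∀ i k, k < j → a' i k = a i k := fun i k h => if_neg h.ne
    refine ⟨a', fun i hi => ?_, fun i k hik hkj g h => ?_, fun i k l h1 h2 h3 h4 => ?_⟩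
    · rcases (Nat.lt_succ_iff.1 hi).eq_or_lt with rfl | hi
      · rw [haj]; exact hc1
      · rw [hak _ _ hi, ha1 i hi]
    · rcases (Nat.lt_succ_iff.1 hkj).eq_or_lt with rfl | hkj
      · rw [haj, hc i (Nat.zero_le _) hik g h]
        congr 1
        refine Finset.sum_congr rfl fun l hl => ?_
        rw [Finset.mem_Ioo] at hl
        rw [haj, hak _ _ hl.2]
      · rw [hak _ _ hkj, ha i k hik hkj g h]
        congr 1
        refine Finset.sum_congr rfl fun l hl => ?_
        rw [Finset.mem_Ioo] at hl
        rw [hak _ _ hkj, hak _ _ (hl.2.trans hkj)]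
    · rcases (Nat.lt_succ_iff.1 h3).eq_or_lt with rfl | h3
      · rw [haj, hc0 i l (Nat.zero_le _) h1 h2 h4]
      · rw [hak _ _ h3, ha0 i k l h1 h2 h3 h4]

omit [IsTopologicalGroup G] in
/-- A defining system gives a homomorphism to the unitriangular group. -/
theorem exists_hom_of_satisfiesAt [Fact p.Prime] {n : ℕ} {a : ℕ → ℕ → C(G, ZMod p)}
    (ha : ∀ i k, i < k → k < n → SatisfiesAt a i k) :
    ∃ φ : G →ₜ* unitriangular n (ZMod p), ∀ x i j, i < j → (φ x).1.1 i j = a i j x := by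
  let M : G → Matrix (Fin n) (Fin n) (ZMod p) := fun x i j =>
    if i < j then a i j x else if i = j then 1 else 0
  have hM1 : ∀ x i, M x i i = 1 := fun x i => by simp [M]
  have hM0 : ∀ x i j, j < i → M x i j = 0 := fun x i j h => by
    simp only [M]; rw [if_neg h.not_gt, if_neg h.ne']
  have hMlt : ∀ x i j, i < j → M x i j = a i j x := fun x i j h => if_pos h
  have hmul : ∀ x y, M (x * y) = M x * M y := by
    intro x y
    ext i j
    rw [Matrix.mul_apply]
    rcases lt_trichotomy i j with h | rfl | h
    · have hsub : ∑ k, M x i k * M y k j = ∑ k ∈ Finset.Icc i j, M x i k * M y k j := by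
        refine (Finset.sum_subset (Finset.subset_univ _) fun k _ hk => ?_).symm
        rw [Finset.mem_Icc, not_and_or, not_le, not_le] at hk
        rcases hk with hk | hk
        · rw [hM0 _ _ _ hk, zero_mul]
        · rw [hM0 _ _ _ hk, mul_zero]
      -- The end terms `k = i` and `k = j` meet a diagonal `1` and give the two linear terms of
      -- `SatisfiesAt`.
      rw [hsub, ← Finset.Ioc_insert_left h.le, Finset.sum_insert (by simp),
        ← Finset.Ioo_insert_right h, Finset.sum_insert (by simp), hM1, hM1, hMlt _ _ _ h,
        hMlt _ _ _ h, hMlt _ _ _ h, ha i j h j.2 x y]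
      have : ∑ k ∈ Finset.Ioo (i : ℕ) j, a i k x * a k j y =
          ∑ k ∈ Finset.Ioo i j, M x i k * M y k j := by
        rw [← Fin.map_valEmbedding_Ioo, Finset.sum_map]
        refine Finset.sum_congr rfl fun k hk => ?_
        rw [Finset.mem_Ioo] at hk
        rw [hMlt _ _ _ hk.1, hMlt _ _ _ hk.2]
        rfl
      rw [this]
      ring
    · rw [Finset.sum_eq_single i, hM1, hM1, hM1, mul_one]
      · intro k _ hk
        rcases lt_or_gt_of_ne hk with h | h
        · rw [hM0 _ _ _ h, zero_mul]
        · rw [hM0 _ _ _ h, mul_zero]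
      · simp
    · rw [hM0 _ _ _ h, Finset.sum_eq_zero]
      intro k _
      rcases lt_or_ge k i with h' | h'
      · rw [hM0 _ _ _ h', zero_mul]
      · rw [hM0 _ _ _ (h.trans_le h'), mul_zero]
  let φ : G →* unitriangular n (ZMod p) :=
    MonoidHom.mk' (fun x => unitriangular.of (M x) (hM1 x) (hM0 x)) fun x y =>
      unitriangular.ext' (hmul x y)
  refine ⟨⟨φ, ?_⟩, fun x i j h => hMlt x i j h⟩
  refine unitriangular.continuous_iff_entries.2 fun i j => ?_
  change Continuous fun x => M x i j
  simp only [M]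
  split_ifs <;> fun_prop

/-- Homomorphisms to `ℤ/p` from a Demushkin group with vanishing consecutive cup products are the
entries next to the diagonal of a unitriangular representation. -/
theorem IsDemushkin.exists_hom_unitriangular [Fact p.Prime] (hG : IsDemushkin p G) {m : ℕ}
    (χ : Fin m → H1 p G)
    (hχ : ∀ k l : Fin m, (k : ℕ) + 1 = l → cup p G (χ k) (χ l) = 0) :
    ∃ φ : G →ₜ* unitriangular (m + 1) (ZMod p),
      ∀ x (k : Fin m), (φ x).1.1 k.castSucc k.succ = (χ k).1 x := by
  -- Padding by zero keeps all consecutive cup products zero.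
  let χ' : ℕ → H1 p G := fun k => if h : k < m then χ ⟨k, h⟩ else 0
  have hχ' : ∀ k (h : k < m), χ' k = χ ⟨k, h⟩ := fun k h => dif_pos h
  obtain ⟨a, ha1, ha, -⟩ := hG.exists_definingSystem χ' (fun k => by
    by_cases h : k + 1 < m
    · rw [hχ' k (by omega), hχ' (k + 1) h]
      exact hχ _ _ rfl
    · have : χ' (k + 1) = 0 := dif_neg h
      rw [this, map_zero]) (m + 1)
  obtain ⟨φ, hφ⟩ := exists_hom_of_satisfiesAt ha
  refine ⟨φ, fun x k => ?_⟩
  rw [hφ x _ _ k.castSucc_lt_succ, Fin.val_castSucc, Fin.val_succ, ha1 k (by omega), hχ' k k.2]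

end Massey

end

/-! ### Bases whose consecutive vectors are orthogonal -/

section Bilinear

variable {K : Type u} {V : Type v} [Field K] [AddCommGroup V] [Module K V]

/-- The first `m` terms of `v` are linearly independent and consecutive ones are orthogonal. -/
structure IsConsecutiveOrtho (B : V →ₗ[K] V →ₗ[K] K) (m : ℕ) (v : ℕ → V) : Prop where
  li : LinearIndependent K fun i : Fin m => v i
  ortho : ∀ k, k + 1 < m → B (v k) (v (k + 1)) = 0

theorem IsConsecutiveOrtho.update {B : V →ₗ[K] V →ₗ[K] K} {m : ℕ} {v : ℕ → V}
    (h : IsConsecutiveOrtho B m v) {w : V} (hw : ∀ k, k + 1 = m → B (v k) w = 0)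
    (hs : w ∉ Submodule.span K (Set.range fun i : Fin m => v i)) :
    IsConsecutiveOrtho B (m + 1) (Function.update v m w) := by
  refine ⟨?_, fun k hk => ?_⟩
  · have : (fun i : Fin (m + 1) => Function.update v m w i) =
        Fin.snoc (α := fun _ => V) (fun i : Fin m => v i) w := by
      ext i
      refine Fin.lastCases ?_ (fun i => ?_) i
      · simp
      · simp [Function.update_of_ne i.2.ne]
    rw [this]
    exact linearIndependent_finSnoc.2 ⟨h.li, hs⟩
  · rw [Function.update_of_ne (by omega)]
    by_cases h2 : k + 1 = m
    · rw [h2, Function.update_self]; exact hw k h2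
    · rw [Function.update_of_ne h2]; exact h.ortho k (by omega)

variable [FiniteDimensional K V]

theorem exists_mem_notMem_span {m : ℕ} {v : Fin m → V} {U : Submodule K V}
    (h : m < Module.finrank K U) : ∃ w ∈ U, w ∉ Submodule.span K (Set.range v) := by
  by_contra! hc
  have h1 := Submodule.finrank_mono (show U ≤ Submodule.span K (Set.range v) from hc)
  have h2 := finrank_range_le_card (R := K) v
  rw [Fintype.card_fin, Set.finrank] at h2
  omega

/-- Greedy choice: the vectors orthogonal to the last one form a hyperplane, which is too large to
lie in the span of the earlier vectors until only the final basis vector is missing. -/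
theorem exists_isConsecutiveOrtho_of_lt {B : V →ₗ[K] V →ₗ[K] K} (hB : B.Nondegenerate) (m : ℕ)
    (hm : m < Module.finrank K V) : ∃ v, IsConsecutiveOrtho B m v := by
  induction m with
  | zero => exact ⟨0, linearIndependent_empty_type, by omega⟩
  | succ m ih =>
    obtain ⟨v, hv⟩ := ih (by omega)
    rcases Nat.eq_zero_or_pos m with rfl | h0
    · obtain ⟨w, -, hw⟩ := exists_mem_notMem_span (v := fun i : Fin 0 => v i)
        (U := (⊤ : Submodule K V)) (by rw [finrank_top]; omega)
      exact ⟨_, hv.update (by omega) hw⟩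
    · have hne : B (v (m - 1)) ≠ 0 := fun h =>
        hv.li.ne_zero ⟨m - 1, by omega⟩ (hB.1 _ fun y => by rw [h]; rfl)
      have hd := Module.Dual.finrank_ker_add_one_of_ne_zero hne
      obtain ⟨w, hw1, hw2⟩ := exists_mem_notMem_span (v := fun i : Fin m => v i)
        (U := LinearMap.ker (B (v (m - 1)))) (by omega)
      refine ⟨_, hv.update (fun k hk => ?_) hw2⟩
      rw [show k = m - 1 by omega]
      exact hw1

/-- The last step of the construction. -/
theorem IsConsecutiveOrtho.exists_succ {B : V →ₗ[K] V →ₗ[K] K} {m : ℕ} {v : ℕ → V}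
    (hv : IsConsecutiveOrtho B (m + 1) v) (hm : Module.finrank K V = m + 2) {j : ℕ} (hj : j ≤ m)
    (hne : B (v m) (v j) ≠ 0) : ∃ v, IsConsecutiveOrtho B (m + 2) v := by
  -- The hyperplane and the span have equal dimension, so containment would be equality; but `v j`
  -- lies in the span and not in the hyperplane.
  obtain ⟨w, hw1, hw2⟩ : ∃ w ∈ LinearMap.ker (B (v m)),
      w ∉ Submodule.span K (Set.range fun i : Fin (m + 1) => v i) := by
    by_contra! hc
    have hB : B (v m) ≠ 0 := fun h => hne (by rw [h]; rfl)
    have hd := Module.Dual.finrank_ker_add_one_of_ne_zero hB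
    have h2 := finrank_span_eq_card hv.li
    rw [Fintype.card_fin] at h2
    have := Submodule.eq_of_le_of_finrank_eq
      (show LinearMap.ker (B (v m)) ≤ Submodule.span K (Set.range fun i : Fin (m + 1) => v i)
        from hc) (by omega)
    refine hne ?_
    have h3 : v j ∈ LinearMap.ker (B (v m)) := by
      rw [this]
      exact Submodule.subset_span ⟨⟨j, by omega⟩, rfl⟩
    exact h3
  refine ⟨_, hv.update (fun k hk => ?_) hw2⟩
  rw [show k = m by omega]
  exact hw1

/-- The last step but one, in dimension at least four. -/
theorem IsConsecutiveOrtho.exists_succ_ne {B : V →ₗ[K] V →ₗ[K] K} (hB : B.Nondegenerate) {m : ℕ}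
    {v : ℕ → V} (hv : IsConsecutiveOrtho B (m + 2) v) (hm : Module.finrank K V = m + 4) :
    ∃ v, IsConsecutiveOrtho B (m + 3) v ∧ ∃ j ≤ m + 2, B (v (m + 2)) (v j) ≠ 0 := by
  have hli : ∀ k, k < m + 2 → v k ≠ 0 := fun k hk => hv.li.ne_zero ⟨k, hk⟩
  set φ := B (v (m + 1)) with hφ
  have hne : φ ≠ 0 := fun h => hli (m + 1) (by omega) (hB.1 _ fun y => by rw [← hφ, h]; rfl)
  have hd := Module.Dual.finrank_ker_add_one_of_ne_zero hne
  obtain ⟨u, hu1, hu2⟩ := exists_mem_notMem_span (v := fun i : Fin (m + 2) => v i)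
    (U := LinearMap.ker φ) (by omega)
  -- Otherwise each `B · (v j)` vanishes on `ker φ` and is a multiple of `φ`. Two independent
  -- vectors `v 0`, `v 1` would then have a nontrivial combination in the right radical.
  obtain ⟨u', hu'1, j, hj, hu'2⟩ : ∃ w ∈ LinearMap.ker φ, ∃ j < m + 2, B w (v j) ≠ 0 := by
    by_contra! hc
    obtain ⟨x, hx⟩ : ∃ x, φ x = 1 := by
      obtain ⟨y, hy⟩ : ∃ y, φ y ≠ 0 := by
        by_contra! h
        exact hne (LinearMap.ext h)
      exact ⟨(φ y)⁻¹ • y, by rw [map_smul, smul_eq_mul, inv_mul_cancel₀ hy]⟩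
    have hf : ∀ j < m + 2, ∀ y, B y (v j) = φ y * B x (v j) := by
      intro j hj y
      have := hc (y - φ y • x) (by rw [LinearMap.mem_ker, map_sub, map_smul, hx]; simp) j hj
      rw [map_sub, map_smul, LinearMap.sub_apply, LinearMap.smul_apply, smul_eq_mul] at this
      linear_combination this
    have h0 : B x (v 1) • v 0 + (-B x (v 0)) • v 1 = 0 := hB.2 _ fun y => by
      rw [map_add, map_smul, map_smul, hf 0 (by omega) y, hf 1 (by omega) y]
      simp only [smul_eq_mul]
      ring
    have hp : LinearIndependent K ![v 0, v 1] := by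
      have := hv.li.comp ![(⟨0, by omega⟩ : Fin (m + 2)), ⟨1, by omega⟩] (by
        intro a b hab
        have := congrArg Fin.val hab
        fin_cases a <;> fin_cases b <;> first | rfl | exact absurd this (by simp))
      convert this using 1
      ext i
      fin_cases i <;> rfl
    have := (LinearIndependent.pair_iff.1 hp _ _ h0).2
    refine hli 0 (by omega) (hB.2 _ fun y => ?_)
    rw [hf 0 (by omega), neg_eq_zero.1 this, mul_zero]
  -- The two conditions on `w` each exclude a proper subspace of `ker φ`, and one of `u`, `u'`, `u +
  -- u'` avoids both.
  obtain ⟨w, hw1, hw2, hw3⟩ : ∃ w ∈ LinearMap.ker φ,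
      w ∉ Submodule.span K (Set.range fun i : Fin (m + 2) => v i) ∧ ∃ j < m + 2, B w (v j) ≠ 0 := by
    by_cases h1 : B u (v j) ≠ 0
    · exact ⟨u, hu1, hu2, j, hj, h1⟩
    by_cases h2 : u' ∈ Submodule.span K (Set.range fun i : Fin (m + 2) => v i)
    · refine ⟨u + u', add_mem hu1 hu'1, fun h => hu2 ?_, j, hj, ?_⟩
      · simpa using sub_mem h h2
      · rw [not_not] at h1
        rwa [map_add, LinearMap.add_apply, h1, zero_add]
    · exact ⟨u', hu'1, h2, j, hj, hu'2⟩
  obtain ⟨j, hj, hw3⟩ := hw3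
  refine ⟨_, hv.update (w := w) (fun k hk => ?_) hw2, j, hj.le, ?_⟩
  · rw [show k = m + 1 by omega]
    exact hw1
  · rwa [Function.update_self, Function.update_of_ne hj.ne]

/-- An alternating form in dimension three is degenerate. -/
theorem exists_apply_self_ne_zero_of_finrank_eq_three {B : V →ₗ[K] V →ₗ[K] K}
    (hB : B.Nondegenerate) (h3 : Module.finrank K V = 3) : ∃ v, B v v ≠ 0 := by
  by_contra! h
  have hs : ∀ x y, B x y = -B y x := fun x y => by
    have := h (x + y)
    simp only [map_add, LinearMap.add_apply, h] at this
    linear_combination this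
  let e := Module.finBasisOfFinrankEq K V h3
  -- The Pfaffian vector of an alternating `3 × 3` matrix lies in its kernel.
  have hz : B (e 1) (e 2) • e 0 + -B (e 0) (e 2) • e 1 + B (e 0) (e 1) • e 2 = 0 := by
    refine hB.1 _ fun y => ?_
    have : B (B (e 1) (e 2) • e 0 + -B (e 0) (e 2) • e 1 + B (e 0) (e 1) • e 2) = 0 := by
      refine e.ext fun i => ?_
      simp only [map_add, map_smul, LinearMap.add_apply, LinearMap.smul_apply, smul_eq_mul,
        LinearMap.zero_apply]
      fin_cases i
      · simp only [Fin.zero_eta, h, hs (e 1) (e 0), hs (e 2) (e 0)]; ring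
      · simp only [Fin.mk_one, h, hs (e 2) (e 1)]; ring
      · simp only [Fin.reduceFinMk, h]; ring
    rw [this, LinearMap.zero_apply]
  have hli := Fintype.linearIndependent_iff.1 e.linearIndependent
    ![B (e 1) (e 2), -B (e 0) (e 2), B (e 0) (e 1)] (by rw [Fin.sum_univ_three]; exact hz)
  refine e.ne_zero 0 (hB.1 _ fun y => ?_)
  have : B (e 0) = 0 := by
    refine e.ext fun i => ?_
    fin_cases i
    · exact h _
    · exact hli 2
    · exact neg_eq_zero.1 (hli 1)
  rw [this, LinearMap.zero_apply]

/-- The middle vector `y` is non-isotropic, `z` is orthogonal to it on both sides, and `x` is left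
orthogonal to it and independent of `z`. Since `B · y` kills `x` and `z` but not `y`, the three are
independent. -/
theorem exists_isConsecutiveOrtho_of_finrank_eq_three {B : V →ₗ[K] V →ₗ[K] K}
    (hB : B.Nondegenerate) (h3 : Module.finrank K V = 3) : ∃ v, IsConsecutiveOrtho B 3 v := by
  obtain ⟨y, hy⟩ := exists_apply_self_ne_zero_of_finrank_eq_three hB h3
  have h1 : B y ≠ 0 := fun h => hy (by rw [h]; rfl)
  have h2 : B.flip y ≠ 0 := fun h => hy (by rw [← LinearMap.flip_apply, h]; rfl)
  have hd1 := Module.Dual.finrank_ker_add_one_of_ne_zero h1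
  have hd2 := Module.Dual.finrank_ker_add_one_of_ne_zero h2
  have hd3 := Submodule.finrank_sup_add_finrank_inf_eq (LinearMap.ker (B y))
    (LinearMap.ker (B.flip y))
  have hd4 := Submodule.finrank_le (LinearMap.ker (B y) ⊔ LinearMap.ker (B.flip y))
  obtain ⟨z, hz, hz0⟩ := exists_mem_notMem_span (K := K) (v := (Fin.elim0 : Fin 0 → V))
    (U := LinearMap.ker (B y) ⊓ LinearMap.ker (B.flip y)) (by omega)
  have hz0 : z ≠ 0 := fun h => hz0 (h ▸ zero_mem _)
  have hz1 : B y z = 0 := hz.1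
  have hz2 : B z y = 0 := hz.2
  obtain ⟨x, hx, hxz⟩ := exists_mem_notMem_span (K := K) (v := fun _ : Fin 1 => z)
    (U := LinearMap.ker (B.flip y)) (by omega)
  have hx : B x y = 0 := hx
  rw [Set.range_const] at hxz
  refine ⟨fun k => if k = 0 then x else if k = 1 then y else z, ?_, fun k hk => ?_⟩
  · have : (fun i : Fin 3 => if (i : ℕ) = 0 then x else if (i : ℕ) = 1 then y else z) =
        ![x, y, z] := by
      ext i; fin_cases i <;> rfl
    rw [this, Fintype.linearIndependent_iff]
    intro g hg
    rw [Fin.sum_univ_three] at hg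
    simp only [Matrix.cons_val] at hg
    have hg1 : g 1 = 0 := by
      have := congrArg (fun w => B w y) hg
      simp only [map_add, map_smul, LinearMap.add_apply, LinearMap.smul_apply, hx, hz2, map_zero,
        LinearMap.zero_apply, smul_eq_mul, mul_zero, zero_add, add_zero] at this
      exact (mul_eq_zero.1 this).resolve_right hy
    rw [hg1, zero_smul, add_zero] at hg
    have hg0 : g 0 = 0 := by
      by_contra h0
      apply hxz
      rw [Submodule.mem_span_singleton]
      refine ⟨-((g 0)⁻¹ * g 2), ?_⟩
      have : g 2 • z = -(g 0 • x) := by rw [eq_neg_iff_add_eq_zero, add_comm]; exact hg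
      rw [neg_smul, mul_smul, this, smul_neg, neg_neg, smul_smul, inv_mul_cancel₀ h0, one_smul]
    rw [hg0, zero_smul, zero_add] at hg
    have hg2 := (smul_eq_zero.1 hg).resolve_right hz0
    intro i
    fin_cases i
    · exact hg0
    · exact hg1
    · exact hg2
  · obtain rfl | rfl : k = 0 ∨ k = 1 := by omega
    · simpa using hx
    · simpa using hz1

/-- A nondegenerate bilinear form has a basis whose consecutive members are orthogonal, unless it
is alternating in dimension two. -/
theorem exists_basis_consecutive_ortho {B : V →ₗ[K] V →ₗ[K] K} (hB : B.Nondegenerate)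
    (h2 : Module.finrank K V = 2 → ∃ v, B v v ≠ 0) :
    ∃ b : Module.Basis (Fin (Module.finrank K V)) K V,
      ∀ k l : Fin (Module.finrank K V), (k : ℕ) + 1 = l → B (b k) (b l) = 0 := by
  suffices H : ∃ v, IsConsecutiveOrtho B (Module.finrank K V) v by
    obtain ⟨v, hv⟩ := H
    refine ⟨Module.Basis.mk hv.li ?_, fun k l hkl => ?_⟩
    · exact (hv.li.span_eq_top_of_card_eq_finrank' (by simp)).ge
    · rw [Module.Basis.mk_apply, Module.Basis.mk_apply, ← hkl]
      exact hv.ortho k (hkl ▸ l.2)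
  obtain h | h | h | h | h : Module.finrank K V = 0 ∨ Module.finrank K V = 1 ∨
      Module.finrank K V = 2 ∨ Module.finrank K V = 3 ∨ 4 ≤ Module.finrank K V := by omega
  · rw [h]
    exact ⟨0, linearIndependent_empty_type, by omega⟩
  · rw [h]
    obtain ⟨w, -, hw⟩ := exists_mem_notMem_span (v := (Fin.elim0 : Fin 0 → V))
      (U := (⊤ : Submodule K V)) (by rw [finrank_top]; omega)
    refine ⟨fun _ => w, LinearIndependent.of_subsingleton 0 fun h => hw (h ▸ zero_mem _), by omega⟩
  · obtain ⟨w, hw⟩ := h2 h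
    rw [h]
    have : IsConsecutiveOrtho B 1 fun _ => w :=
      ⟨LinearIndependent.of_subsingleton 0 fun h => hw (by simp_all), by omega⟩
    exact this.exists_succ h le_rfl hw
  · rw [h]
    exact exists_isConsecutiveOrtho_of_finrank_eq_three hB h
  · obtain ⟨m, hm⟩ := Nat.exists_eq_add_of_le' h
    obtain ⟨v, hv⟩ := exists_isConsecutiveOrtho_of_lt hB (m + 2) (by omega)
    obtain ⟨v, hv, j, hj, hne⟩ := hv.exists_succ_ne hB hm
    rw [hm]
    exact hv.exists_succ hm hj hne

end Bilinear

/-! ### Arranging blocks -/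

/-- Blocks of two elements which must not be adjacent can be ordered together with other blocks,
unless there is only one nonempty block. -/
theorem exists_equiv_sigma_consecutive {I : Type v} [Finite I] (r : I → ℕ) (good : I → Prop)
    (h2 : ∀ i, ¬ good i → r i = 2) (hne : ∀ i, ¬ good i → ∃ j ≠ i, r j ≠ 0) {N : ℕ}
    (e₀ : Fin N ≃ Σ i, Fin (r i)) :
    ∃ e : Fin N ≃ Σ i, Fin (r i), ∀ k l : Fin N, (k : ℕ) + 1 = l → ∀ i x y,
      e k = ⟨i, x⟩ → e l = ⟨i, y⟩ → good i ∧ (x : ℕ) + 1 = y := by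
  classical
  obtain ⟨M, ⟨idx⟩⟩ := Finite.exists_equiv_fin I
  -- Order: first the initial vectors of all bad blocks, then the good blocks, then the second
  -- vectors of the bad blocks. Ties are broken by block and then by position.
  let c : (Σ i, Fin (r i)) → ℕ := fun z => if good z.1 then 1 else 2 * z.2
  let key : (Σ i, Fin (r i)) → ℕ ×ₗ (ℕ ×ₗ ℕ) := fun z =>
    toLex (c z, toLex ((idx z.1 : ℕ), (z.2 : ℕ)))
  have hkey : ∀ z w, key z < key w ↔ c z < c w ∨ c z = c w ∧
      ((idx z.1 : ℕ) < idx w.1 ∨ (idx z.1 : ℕ) = idx w.1 ∧ (z.2 : ℕ) < w.2) := fun z w => by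
    simp only [key, Prod.Lex.toLex_lt_toLex]
  have hinj : Function.Injective key := by
    rintro ⟨i, x⟩ ⟨j, y⟩ h
    simp only [key, EmbeddingLike.apply_eq_iff_eq, Prod.mk.injEq] at h
    obtain ⟨-, h1, h3⟩ := h
    obtain rfl : i = j := idx.injective (Fin.ext h1)
    rw [Fin.ext h3]
  let e := (Tuple.sort (key ∘ e₀)).trans e₀
  have hmono : StrictMono (key ∘ e) :=
    (Tuple.monotone_sort (key ∘ e₀)).strictMono_of_injective (hinj.comp e.injective)
  have hno : ∀ k l : Fin N, (k : ℕ) + 1 = l → ∀ z, ¬ (key (e k) < key z ∧ key z < key (e l)) := by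
    rintro k l hkl z ⟨h1, h3⟩
    obtain ⟨t, rfl⟩ := e.surjective z
    have h1 := Fin.lt_def.1 (hmono.lt_iff_lt.1 h1)
    have h3 := Fin.lt_def.1 (hmono.lt_iff_lt.1 h3)
    omega
  refine ⟨e, fun k l hkl i x y hx hy => ?_⟩
  have hlt : key (e k) < key (e l) := hmono (Fin.lt_def.2 (by omega))
  have hno := hno k l hkl
  rw [hx, hy] at hno hlt
  have hcg : ∀ j z, good j → c ⟨j, z⟩ = 1 := fun j z h => if_pos h
  have hcb : ∀ j z, ¬ good j → c ⟨j, z⟩ = 2 * z := fun j z h => if_neg h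
  by_cases hg : good i
  · refine ⟨hg, ?_⟩
    rw [hkey] at hlt
    simp only [hcg i _ hg] at hlt
    by_contra hxy
    refine hno ⟨i, ⟨x + 1, by omega⟩⟩ ⟨(hkey _ _).2 (Or.inr ⟨?_, Or.inr ⟨rfl, ?_⟩⟩),
      (hkey _ _).2 (Or.inr ⟨?_, Or.inr ⟨rfl, ?_⟩⟩)⟩
    · rw [hcg i _ hg, hcg i _ hg]
    · exact Nat.lt_succ_self _
    · rw [hcg i _ hg, hcg i _ hg]
    · change (x : ℕ) + 1 < y
      omega
  · exfalso
    have hr := h2 i hg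
    rw [hkey] at hlt
    simp only [hcb i _ hg] at hlt
    have hx0 : (x : ℕ) = 0 := by omega
    have hy1 : (y : ℕ) = 1 := by omega
    -- Any other nonempty block separates the two vectors: a good one lies in the middle layer, a
    -- bad one with larger index by its first vector, and one with smaller index by its second.
    obtain ⟨j, hji, hj⟩ := hne i hg
    have hidx : (idx j : ℕ) ≠ idx i := fun h => hji (idx.injective (Fin.ext h))
    by_cases hgj : good j
    · refine hno ⟨j, ⟨0, by omega⟩⟩ ⟨(hkey _ _).2 (Or.inl ?_), (hkey _ _).2 (Or.inl ?_)⟩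
      · rw [hcg j _ hgj, hcb i _ hg]; omega
      · rw [hcg j _ hgj, hcb i _ hg]; omega
    · have hrj := h2 j hgj
      rcases lt_or_gt_of_ne hidx with h | h
      · refine hno ⟨j, ⟨1, by omega⟩⟩ ⟨(hkey _ _).2 (Or.inl ?_), (hkey _ _).2 (Or.inr ?_)⟩
        · rw [hcb j _ hgj, hcb i _ hg]; simp only; omega
        · rw [hcb j _ hgj, hcb i _ hg]; simp only; omega
      · refine hno ⟨j, ⟨0, by omega⟩⟩ ⟨(hkey _ _).2 (Or.inr ?_), (hkey _ _).2 (Or.inl ?_)⟩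
        · rw [hcb j _ hgj, hcb i _ hg]; simp only; omega
        · rw [hcb j _ hgj, hcb i _ hg]; simp only; omega

noncomputable section

/-! ### Functoriality of cohomology -/

section Functoriality

variable {p : ℕ} {A : Type u} {G : Type v} [Group A] [TopologicalSpace A] [IsTopologicalGroup A]
  [Group G] [TopologicalSpace G] [IsTopologicalGroup G]

/-- Restriction of elements of `H¹` along a continuous homomorphism. -/
def H1.comap (f : A →ₜ* G) : H1 p G →ₗ[ZMod p] H1 p A where
  toFun χ := H1.mk (χ.1.comp ⟨f, f.continuous_toFun⟩) fun x y => by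
    change χ.1 (f (x * y)) = χ.1 (f x) + χ.1 (f y)
    rw [_root_.map_mul, χ.map_mul]
  map_add' _ _ := rfl
  map_smul' _ _ := rfl

@[simp] theorem H1.comap_apply (f : A →ₜ* G) (χ : H1 p G) (x : A) :
    (H1.comap f χ).1 x = χ.1 (f x) := rfl

/-- Restriction of `2`-cocycles along a continuous homomorphism. -/
def Z2.comap (f : A →ₜ* G) : Z2 p G →ₗ[ZMod p] Z2 p A where
  toFun z := ⟨z.1.comp ⟨fun x => (f x.1, f x.2), by
    have := f.continuous_toFun
    exact (this.comp continuous_fst).prodMk (this.comp continuous_snd)⟩, by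
    rw [LinearMap.mem_ker]
    ext ⟨x, y, z'⟩
    have := DFunLike.congr_fun (LinearMap.mem_ker.1 z.2) (f x, f y, f z')
    simpa [cochainD2] using this⟩
  map_add' _ _ := rfl
  map_smul' _ _ := rfl

theorem Z2.comap_apply (f : A →ₜ* G) (z : Z2 p G) (x : A × A) :
    (Z2.comap f z).1 x = z.1 (f x.1, f x.2) := rfl

/-- Restriction on `H²`. -/
def H2.comap (f : A →ₜ* G) : H2 p G →ₗ[ZMod p] H2 p A :=
  Submodule.mapQ _ _ (Z2.comap f) (by
    rintro z ⟨c, hc⟩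
    refine ⟨c.comp ⟨f, f.continuous_toFun⟩, ?_⟩
    ext x
    have := DFunLike.congr_fun hc (f x.1, f x.2)
    simpa [cochainD1, Z2.comap_apply] using this)

theorem H2.comap_cup (f : A →ₜ* G) (χ ψ : H1 p G) :
    H2.comap f (cup p G χ ψ) = cup p A (H1.comap f χ) (H1.comap f ψ) := rfl

theorem H2.comap_comap {f : A →ₜ* G} {g : G →ₜ* A} (h : ∀ x, f (g x) = x) (z : H2 p G) :
    H2.comap g (H2.comap f z) = z := by
  obtain ⟨z, rfl⟩ := Submodule.Quotient.mk_surjective _ z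
  have : Z2.comap g (Z2.comap f z) = z := by
    ext x
    simp [Z2.comap_apply, h]
  exact congrArg Submodule.Quotient.mk this

theorem H1.comap_comap {f : A →ₜ* G} {g : G →ₜ* A} (h : ∀ x, f (g x) = x) (χ : H1 p G) :
    H1.comap g (H1.comap f χ) = χ := by
  ext x
  simp [h]

/-- The Demushkin property is invariant under isomorphism. -/
theorem IsDemushkin.of_inverse [Fact p.Prime] (hA : IsDemushkin p A) (hG : IsProP p G) {f : A →ₜ* G}
    {g : G →ₜ* A} (hfg : ∀ x, f (g x) = x) (hgf : ∀ x, g (f x) = x) : IsDemushkin p G := by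
  have := hA.finite_H1
  have hcup : ∀ (χ : H1 p G) (ψ : H1 p A), cup p A (H1.comap f χ) ψ =
      H2.comap f (cup p G χ (H1.comap g ψ)) := fun χ ψ => by
    rw [H2.comap_cup, H1.comap_comap hgf]
  have hcup' : ∀ (χ : H1 p A) (ψ : H1 p G), cup p A χ (H1.comap f ψ) =
      H2.comap f (cup p G (H1.comap g χ) ψ) := fun χ ψ => by
    rw [H2.comap_cup, H1.comap_comap hgf]
  refine ⟨hG, ?_, ?_, fun χ h => ?_, fun χ h => ?_⟩
  · exact Module.Finite.of_injective (H1.comap f)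
      (Function.LeftInverse.injective (H1.comap_comap hfg))
  · rw [← hA.finrank_H2]
    exact (LinearEquiv.ofBijective (H2.comap (p := p) f)
      ⟨Function.LeftInverse.injective (H2.comap_comap hfg),
        Function.RightInverse.surjective (H2.comap_comap hgf)⟩).finrank_eq
  · rw [← H1.comap_comap hfg χ, hA.nondegenerate_cup.1 (H1.comap f χ) fun ψ => by
      rw [hcup, h, map_zero], map_zero]
  · rw [← H1.comap_comap hfg χ, hA.nondegenerate_cup.2 (H1.comap f χ) fun ψ => by
      rw [hcup', h, map_zero], map_zero]

end Functoriality

/-! ### Universal properties for finite targets -/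

theorem IsProP.of_finite {p : ℕ} {T : Type u} [Group T] [TopologicalSpace T]
    [IsTopologicalGroup T] [Finite T] [DiscreteTopology T] (hT : IsPGroup p T) : IsProP p T :=
  ⟨inferInstance, inferInstance, fun N _ _ => hT.to_quotient N⟩

/-- The universal properties test targets in `Type u`, whereas the finite groups used as targets
live in `Type`. -/
theorem IsProP.ulift_of_finite {p : ℕ} {T : Type v} [Group T] [TopologicalSpace T]
    [IsTopologicalGroup T] [Finite T] [DiscreteTopology T] (hT : IsPGroup p T) :
    IsProP p (ULift.{u} T) := by
  have : DiscreteTopology (ULift.{u} T) :=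
    DiscreteTopology.of_continuous_injective continuous_uliftDown ULift.down_injective
  exact IsProP.of_finite (hT.of_equiv MulEquiv.ulift.symm)

/-- The continuous isomorphism to the lifted group. -/
def ContinuousMonoidHom.uliftUp (T : Type v) [Group T] [TopologicalSpace T] :
    T →ₜ* ULift.{u} T :=
  { toFun := ULift.up, map_one' := rfl, map_mul' := fun _ _ => rfl,
    continuous_toFun := continuous_uliftUp }

/-- The continuous isomorphism from the lifted group. -/
def ContinuousMonoidHom.uliftDown (T : Type v) [Group T] [TopologicalSpace T] :
    ULift.{u} T →ₜ* T :=
  { toFun := ULift.down, map_one' := rfl, map_mul' := fun _ _ => rfl,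
    continuous_toFun := continuous_uliftDown }

section Universal

variable {p : ℕ} {T : Type} [Group T] [TopologicalSpace T]
  [IsTopologicalGroup T] [Finite T] [DiscreteTopology T]

theorem IsFreeProPProduct.existsUnique_finite {I : Type v} {A : I → Type u} [∀ i, Group (A i)]
    [∀ i, TopologicalSpace (A i)] {G : Type u} [Group G] [TopologicalSpace G]
    [IsTopologicalGroup G] {ι : ∀ i, A i →ₜ* G} (hι : IsFreeProPProduct p A G ι)
    (hT : IsPGroup p T) (ψ : ∀ i, A i →ₜ* T) : ∃! φ : G →ₜ* T, ∀ i x, φ (ι i x) = ψ i x := by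
  obtain ⟨-, h⟩ := hι
  obtain ⟨φ, hφ, huniq⟩ := h (ULift.{u} T) (IsProP.ulift_of_finite hT)
    fun i => (ContinuousMonoidHom.uliftUp T).comp (ψ i)
  refine ⟨(ContinuousMonoidHom.uliftDown T).comp φ, fun i x => congrArg ULift.down (hφ i x),
    fun φ' hφ' => ?_⟩
  rw [← huniq ((ContinuousMonoidHom.uliftUp T).comp φ') fun i x => congrArg ULift.up (hφ' i x)]
  rfl

end Universal

/-! ### Characters next to the diagonal; representations of free pro-`p` groups. -/

section H1Hom

variable {p : ℕ} {G : Type u} [Group G] [TopologicalSpace G] [IsTopologicalGroup G]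

/-- An element of `H¹` as a continuous homomorphism. -/
def H1.toHom (χ : H1 p G) : G →ₜ* Multiplicative (ZMod p) where
  toFun x := Multiplicative.ofAdd (χ.1 x)
  map_one' := by rw [χ.map_one]; rfl
  map_mul' x y := by rw [χ.map_mul]; rfl
  continuous_toFun := continuous_ofAdd.comp χ.1.continuous

/-- A continuous homomorphism to `ℤ/p` as an element of `H¹`. -/
def H1.ofHom (f : G →ₜ* Multiplicative (ZMod p)) : H1 p G :=
  H1.mk ⟨fun x => (f x).toAdd, continuous_toAdd.comp f.continuous_toFun⟩ fun x y => by simp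

theorem isPGroup_multiplicative_zmod [Fact p.Prime] : IsPGroup p (Multiplicative (ZMod p)) :=
  IsPGroup.of_card (n := 1) (by simp)

/-- The elements of `H¹` next to the diagonal of a unitriangular representation. -/
def unitriangular.superdiagH1 {m : ℕ} (φ : G →ₜ* unitriangular (m + 1) (ZMod p)) (k : Fin m) :
    H1 p G :=
  H1.mk ⟨fun x => (φ x).1.1 k.castSucc k.succ,
    unitriangular.continuous_iff_entries.1 φ.continuous_toFun _ _⟩ fun x y => by
      change (φ (x * y)).1.1 _ _ = _
      rw [map_mul, ← unitriangular.superdiag_apply, map_mul, toAdd_mul]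
      rfl

theorem unitriangular.superdiagH1_apply {m : ℕ} (φ : G →ₜ* unitriangular (m + 1) (ZMod p))
    (k : Fin m) (x : G) : (superdiagH1 φ k).1 x = (φ x).1.1 k.castSucc k.succ := rfl

/-- A preimage of the elementary matrix at position `k` next to the diagonal isolates the `k`-th
coefficient of a relation. -/
theorem unitriangular.superdiagH1_linearIndependent [Fact p.Prime] {m : ℕ}
    {φ : G →ₜ* unitriangular (m + 1) (ZMod p)} (hφ : Function.Surjective φ) :
    LinearIndependent (ZMod p) (superdiagH1 φ) := by
  rw [Fintype.linearIndependent_iff]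
  intro c hc k
  obtain ⟨x, hx⟩ := hφ (elem k.castSucc k.succ k.castSucc_lt_succ 1)
  have := DFunLike.congr_fun (congrArg Subtype.val hc) x
  simpa [superdiagH1_apply, hx, superdiag_elem] using this

theorem unitriangular.surjective_of_linearIndependent [Fact p.Prime] {m : ℕ}
    {φ : G →ₜ* unitriangular (m + 1) (ZMod p)}
    (h : LinearIndependent (ZMod p) (superdiagH1 φ)) : Function.Surjective φ := by
  refine surjective_of_superdiag φ.toMonoidHom fun c hc => ?_
  rw [Fintype.linearIndependent_iff] at h
  refine funext fun k => h c ?_ k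
  ext x
  simpa [superdiagH1_apply] using hc x

variable [Fact p.Prime]

/-- Homomorphisms from a free pro-`p` group to the unitriangular group can have arbitrary entries
next to the diagonal. -/
theorem IsFreeProP.exists_hom_unitriangular (hG : IsFreeProP p G) {m : ℕ} (χ : Fin m → H1 p G) :
    ∃ φ : G →ₜ* unitriangular (m + 1) (ZMod p), unitriangular.superdiagH1 φ = χ := by
  obtain ⟨-, X, b, hb, huniv⟩ := hG
  -- As `𝔽_p` is discrete, each character kills almost all generators, so the matrices chosen below
  -- converge to `1`.
  have hχ : ∀ χ : H1 p G, ∀ᶠ x in cofinite, χ.1 (b x) = 0 := fun χ => by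
    have h1 : Tendsto (fun x => χ.1 (b x)) cofinite (𝓝 0) := by
      have := (χ.1.continuous.tendsto 1).comp hb
      rwa [χ.map_one] at this
    rw [nhds_discrete, tendsto_pure] at h1
    exact h1
  let f : X → unitriangular (m + 1) (ZMod p) := fun x =>
    unitriangular.of (1 + Matrix.of fun i j => ∑ k : Fin m,
        if i = k.castSucc ∧ j = k.succ then (χ k).1 (b x) else 0)
      (fun i => by
        simp only [Matrix.add_apply, Matrix.one_apply_eq, Matrix.of_apply, add_eq_left]
        refine Finset.sum_eq_zero fun k _ => if_neg ?_
        rintro ⟨h1, h2⟩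
        exact k.castSucc_lt_succ.ne (h1.symm.trans h2))
      (fun i j hij => by
        simp only [Matrix.add_apply, Matrix.one_apply_ne hij.ne', Matrix.of_apply, zero_add]
        refine Finset.sum_eq_zero fun k _ => if_neg ?_
        rintro ⟨rfl, rfl⟩
        exact k.castSucc_lt_succ.not_gt hij)
  have hf : ∀ x (k : Fin m), (f x).1.1 k.castSucc k.succ = (χ k).1 (b x) := fun x k => by
    simp only [f, unitriangular.of_val, Matrix.add_apply, Matrix.of_apply,
      Matrix.one_apply_ne k.castSucc_lt_succ.ne, zero_add, Fin.castSucc_inj, Fin.succ_inj, and_self]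
    rw [Finset.sum_ite_eq, if_pos (Finset.mem_univ _)]
  have hlim : Tendsto f cofinite (𝓝 1) := by
    rw [nhds_discrete, tendsto_pure]
    filter_upwards [eventually_all.2 fun k => hχ (χ k)] with x hx
    apply unitriangular.ext'
    ext i j
    simp [f, hx]
  obtain ⟨φ, hφ, -⟩ := huniv (ULift.{u} (unitriangular (m + 1) (ZMod p)))
    (IsProP.ulift_of_finite unitriangular.isPGroup) (fun x => ULift.up (f x))
    ((continuous_uliftUp.tendsto 1).comp hlim)
  refine ⟨(ContinuousMonoidHom.uliftDown _).comp φ, funext fun k => ?_⟩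
  have hk : Tendsto (fun x => ULift.up.{u} (Multiplicative.ofAdd ((χ k).1 (b x)))) cofinite
      (𝓝 1) := by
    refine tendsto_nhds_of_eventually_eq ?_
    filter_upwards [hχ (χ k)] with x hx
    rw [hx]; rfl
  -- Uniqueness for the target `ℤ/p`: characters that agree on the generators are equal.
  have hZ := huniv (ULift.{u} (Multiplicative (ZMod p)))
    (IsProP.ulift_of_finite isPGroup_multiplicative_zmod) _ hk
  have := hZ.unique (y₁ := (ContinuousMonoidHom.uliftUp _).comp
      (H1.toHom (unitriangular.superdiagH1 ((ContinuousMonoidHom.uliftDown _).comp φ) k)))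
    (y₂ := (ContinuousMonoidHom.uliftUp _).comp (H1.toHom (χ k)))
    (fun x => congrArg (fun t => ULift.up (Multiplicative.ofAdd t)) (by
      rw [← hf]
      change (φ (b x)).down.1.1 _ _ = _
      rw [hφ])) (fun x => rfl)
  ext x
  exact congrArg (fun t => (ULift.down t).toAdd) (DFunLike.congr_fun this x)

end H1Hom

/-! ### Free products -/

section FreeProduct

variable {p : ℕ} [Fact p.Prime] {I : Type v} {A : I → Type u} [∀ i, Group (A i)]
  [∀ i, TopologicalSpace (A i)] [∀ i, IsTopologicalGroup (A i)]
  {G : Type u} [Group G] [TopologicalSpace G] [IsTopologicalGroup G] {ι : ∀ i, A i →ₜ* G}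

/-- `H¹` of a free product is the product of the `H¹` of the factors. -/
def IsFreeProPProduct.H1Equiv (hι : IsFreeProPProduct p A G ι) :
    H1 p G ≃ₗ[ZMod p] ∀ i, H1 p (A i) :=
  LinearEquiv.ofBijective (LinearMap.pi fun i => H1.comap (ι i)) (by
    constructor
    · intro χ ψ h
      have := (hι.existsUnique_finite isPGroup_multiplicative_zmod
        fun i => (H1.comap (ι i) χ).toHom).unique (y₁ := χ.toHom) (y₂ := ψ.toHom)
        (fun i x => rfl) (fun i x => by
          have h1 := congrFun h i
          simp only [LinearMap.pi_apply] at h1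
          rw [h1]; rfl)
      ext x
      exact congrArg Multiplicative.toAdd (DFunLike.congr_fun this x)
    · intro χ
      obtain ⟨φ, hφ, -⟩ := hι.existsUnique_finite isPGroup_multiplicative_zmod
        fun i => (χ i).toHom
      refine ⟨H1.ofHom φ, funext fun i => ?_⟩
      ext x
      exact congrArg Multiplicative.toAdd (hφ i x))

theorem IsFreeProPProduct.H1Equiv_apply (hι : IsFreeProPProduct p A G ι) (χ : H1 p G) (i : I) :
    hι.H1Equiv χ i = H1.comap (ι i) χ := rfl

omit [Fact p.Prime] in
/-- A free product all of whose factors but one are trivial. -/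
theorem IsFreeProPProduct.exists_inverse (hι : IsFreeProPProduct p A G ι) {i : I}
    (hi : IsProP p (A i)) (h : ∀ j ≠ i, Subsingleton (A j)) :
    ∃ g : G →ₜ* A i, (∀ x, ι i (g x) = x) ∧ ∀ x, g (ι i x) = x := by
  classical
  -- The retraction onto `A i`. Composed with `ι i` it agrees with the identity on every factor,
  -- hence is the identity of `G`.
  obtain ⟨g, hg, -⟩ := hι.2 (A i) hi
    (Function.update (fun j => (1 : A j →ₜ* A i)) i (ContinuousMonoidHom.id (A i)))
  have hgi : ∀ x, g (ι i x) = x := fun x => by rw [hg, Function.update_self]; rfl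
  refine ⟨g, fun x => ?_, hgi⟩
  have := (hι.2 G hι.1 ι).unique (y₁ := (ι i).comp g) (y₂ := ContinuousMonoidHom.id G)
    (fun j x => by
      by_cases hj : j = i
      · subst hj
        exact congrArg _ (hgi x)
      · have := h j hj
        rw [Subsingleton.elim x 1, map_one, map_one]) (fun j x => rfl)
  exact DFunLike.congr_fun this x

/-- A Demushkin group has a basis of `H¹` with vanishing consecutive cup products, unless it has
rank two and all squares vanish. -/
theorem IsDemushkin.exists_basis_consecutive (hG : IsDemushkin p G)
    (h2 : Module.finrank (ZMod p) (H1 p G) = 2 → ∃ χ, cup p G χ χ ≠ 0) :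
    ∃ b : Module.Basis (Fin (Module.finrank (ZMod p) (H1 p G))) (ZMod p) (H1 p G),
      ∀ k l : Fin (Module.finrank (ZMod p) (H1 p G)), (k : ℕ) + 1 = l → cup p G (b k) (b l) = 0 := by
  have := hG.finite_H1
  have : Module.Finite (ZMod p) (H2 p G) :=
    Module.finite_of_finrank_pos (by rw [hG.finrank_H2]; exact one_pos)
  let e : H2 p G ≃ₗ[ZMod p] ZMod p :=
    LinearEquiv.ofFinrankEq _ _ (by rw [hG.finrank_H2, Module.finrank_self])
  let B := (cup p G).compr₂ e.toLinearMap
  have hB : ∀ χ ψ, B χ ψ = 0 ↔ cup p G χ ψ = 0 := fun χ ψ => e.map_eq_zero_iff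
  obtain ⟨b, hb⟩ := exists_basis_consecutive_ortho (B := B)
    ⟨fun χ h => hG.nondegenerate_cup.1 χ fun ψ => (hB _ _).1 (h ψ),
      fun χ h => hG.nondegenerate_cup.2 χ fun ψ => (hB _ _).1 (h ψ)⟩
    fun h => (h2 h).imp fun χ hχ h => hχ ((hB _ _).1 h)
  exact ⟨b, fun k l hkl => (hB _ _).1 (hb k l hkl)⟩

/-- Linearly independent families with vanishing consecutive cup products on the Demushkin
factors. -/
theorem exists_linearIndependent_consecutive [Finite I]
    (hA : ∀ i, IsFreeProP p (A i) ∨ IsDemushkin p (A i)) (hι : IsFreeProPProduct p A G ι)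
    [Module.Finite (ZMod p) (H1 p G)] {m : ℕ}
    (hm : m ≤ Module.finrank (ZMod p) (H1 p G))
    (hexc : ¬ (m = 2 ∧ Module.finrank (ZMod p) (H1 p G) = 2 ∧ IsDemushkin p G ∧
      ∀ χ : H1 p G, cup p G χ χ = 0)) :
    ∃ χ : Fin m → ∀ i, H1 p (A i), LinearIndependent (ZMod p) χ ∧
      ∀ k l : Fin m, (k : ℕ) + 1 = l → ∀ i, IsDemushkin p (A i) → cup p (A i) (χ k i) (χ l i) = 0 := by
  classical
  have : Fintype I := Fintype.ofFinite I
  have hfin : Module.Finite (ZMod p) (∀ i, H1 p (A i)) := Module.Finite.equiv hι.H1Equiv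
  have hfini : ∀ i, Module.Finite (ZMod p) (H1 p (A i)) := fun i =>
    Module.Finite.of_surjective (LinearMap.proj (R := ZMod p) (φ := fun i => H1 p (A i)) i)
      (LinearMap.proj_surjective i)
  have hsum : Module.finrank (ZMod p) (H1 p G) = ∑ i, Module.finrank (ZMod p) (H1 p (A i)) := by
    rw [hι.H1Equiv.finrank_eq, Module.finrank_pi_fintype]
  -- With fewer than two characters there is no consecutive pair, so any independent family will do.
  rcases Nat.lt_or_ge m 2 with hm2 | hm2
  · let b := Module.finBasis (ZMod p) (∀ i, H1 p (A i))
    rw [hι.H1Equiv.finrank_eq] at hm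
    exact ⟨b ∘ Fin.castLE hm, b.linearIndependent.comp _ (Fin.castLE_injective hm), by omega⟩
  let r : I → ℕ := fun i => Module.finrank (ZMod p) (H1 p (A i))
  let good : I → Prop := fun i => ∃ b : Module.Basis (Fin (r i)) (ZMod p) (H1 p (A i)),
    ∀ k l : Fin (r i), (k : ℕ) + 1 = l → IsDemushkin p (A i) → cup p (A i) (b k) (b l) = 0
  have hbad : ∀ i, ¬ good i → IsDemushkin p (A i) ∧ r i = 2 ∧ ∀ χ, cup p (A i) χ χ = 0 := by
    intro i hi
    have hD : IsDemushkin p (A i) := by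
      by_contra hD
      exact hi ⟨Module.finBasis _ _, fun k l _ h => absurd h hD⟩
    by_contra! hc
    obtain ⟨b, hb⟩ := hD.exists_basis_consecutive (hc hD)
    exact hi ⟨b, fun k l hkl _ => hb k l hkl⟩
  -- If a bad factor were the only one with nonzero `H¹`, the others would be trivial and `G`
  -- isomorphic to it, with `2 ≤ m ≤ 2`: the excluded case.
  have hne : ∀ i, ¬ good i → ∃ j ≠ i, r j ≠ 0 := by
    intro i hi
    by_contra! hc
    obtain ⟨hD, hr, hχ⟩ := hbad i hi
    have hd : Module.finrank (ZMod p) (H1 p G) = 2 := by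
      rw [hsum, Finset.sum_eq_single i (fun j _ hj => hc j hj) (by simp)]
      exact hr
    obtain ⟨g, hg1, hg2⟩ := hι.exists_inverse hD.isProP fun j hj => by
      have : Subsingleton (H1 p (A j)) := Module.finrank_zero_iff.1 (hc j hj)
      exact ((hA j).elim (fun h => h.1) fun h => h.isProP).subsingleton_of_H1
    refine hexc ⟨by omega, hd, hD.of_inverse hι.1 hg1 hg2, fun χ => ?_⟩
    rw [← H2.comap_comap hg1 (cup p G χ χ), H2.comap_cup, hχ, map_zero]
  have hb : ∀ i, ∃ b : Module.Basis (Fin (r i)) (ZMod p) (H1 p (A i)), good i →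
      ∀ k l : Fin (r i), (k : ℕ) + 1 = l → IsDemushkin p (A i) →
        cup p (A i) (b k) (b l) = 0 := by
    intro i
    by_cases hi : good i
    · obtain ⟨b, hb⟩ := hi
      exact ⟨b, fun _ => hb⟩
    · exact ⟨Module.finBasis _ _, fun h => absurd h hi⟩
  choose b hb using hb
  let b' : Module.Basis (Σ i, Fin (r i)) (ZMod p) (∀ i, H1 p (A i)) := Pi.basis b
  obtain ⟨e, he⟩ := exists_equiv_sigma_consecutive r good (fun i hi => (hbad i hi).2.1) hne
    (N := Module.finrank (ZMod p) (H1 p G))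
    (Fintype.equivOfCardEq (by rw [Fintype.card_fin, hsum, Fintype.card_sigma]; simp [r]))
  refine ⟨fun k => b' (e (Fin.castLE hm k)), b'.linearIndependent.comp _
    (e.injective.comp (Fin.castLE_injective hm)), fun k l hkl i hD => ?_⟩
  have hk := he (Fin.castLE hm k) (Fin.castLE hm l) hkl
  change cup p (A i) (b' (e (Fin.castLE hm k)) i) (b' (e (Fin.castLE hm l)) i) = 0
  generalize e (Fin.castLE hm k) = z at hk ⊢
  generalize e (Fin.castLE hm l) = z' at hk ⊢
  obtain ⟨j, x⟩ := z
  obtain ⟨j', y⟩ := z'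
  simp only [b', Pi.basis_apply]
  -- Each basis vector is supported on one factor, so only pairs from the same factor can have a
  -- nonzero cup product there.
  by_cases hj : j = i
  · by_cases hj' : j' = i
    · subst hj
      subst hj'
      obtain ⟨hg, hxy⟩ := hk j' x y rfl rfl
      rw [Pi.single_eq_same, Pi.single_eq_same]
      exact hb j' hg x y hxy hD
    · rw [Pi.single_eq_of_ne (Ne.symm hj'), map_zero]
  · rw [Pi.single_eq_of_ne (Ne.symm hj), map_zero, LinearMap.zero_apply]

end FreeProduct

end

theorem mainTheorem4 (p : ℕ) [Fact p.Prime]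
    (G : Type u) [Group G] [TopologicalSpace G] [IsTopologicalGroup G]
    (hG : IsProP p G) (d : ℕ) (hd : HasRank G d)
    (I : Type v) [Finite I]
    (A : I → Type u) [∀ i, Group (A i)] [∀ i, TopologicalSpace (A i)]
    [∀ i, IsTopologicalGroup (A i)]
    (hA : ∀ i, IsFreeProP p (A i) ∨ IsDemushkin p (A i))
    (ι : ∀ i, A i →ₜ* G) (hι : IsFreeProPProduct p A G ι)
    (n : ℕ) (hn : 2 ≤ n)
    (hexc : ¬ (n = 3 ∧ d = 2 ∧ IsDemushkin p G ∧ ∀ χ : H1 p G, cup p G χ χ = 0)) :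
    (∃ φ : G →ₜ* unitriangular n (ZMod p), Function.Surjective φ) ↔ n ≤ d + 1 := by
  obtain ⟨m, rfl⟩ := Nat.exists_eq_add_of_le' (one_le_two.trans hn)
  have hfin := hd.finite_H1 (p := p)
  have hrank := hd.finrank_H1 hG
  constructor
  · rintro ⟨φ, hφ⟩
    have := (unitriangular.superdiagH1_linearIndependent hφ).fintype_card_le_finrank
    rw [Fintype.card_fin, hrank] at this
    omega
  · intro hnd
    obtain ⟨χ, hχ, hcup⟩ := exists_linearIndependent_consecutive hA hι (m := m) (by omega) (by
      rintro ⟨h1, h2, h3⟩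
      exact hexc ⟨by omega, by omega, h3⟩)
    have hloc : ∀ i, ∃ ψ : A i →ₜ* unitriangular (m + 1) (ZMod p),
        unitriangular.superdiagH1 ψ = fun k => χ k i := by
      intro i
      rcases hA i with h | h
      · exact h.exists_hom_unitriangular _
      · obtain ⟨ψ, hψ⟩ := h.exists_hom_unitriangular (fun k => χ k i) fun k l hkl =>
          hcup k l hkl i h
        refine ⟨ψ, funext fun k => ?_⟩
        ext x
        exact hψ x k
    choose ψ hψ using hloc
    obtain ⟨φ, hφ, -⟩ := hι.existsUnique_finite unitriangular.isPGroup ψ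
    refine ⟨φ, unitriangular.surjective_of_linearIndependent ?_⟩
    -- Characters of `G` are determined by their restrictions to the factors, so independence of `χ`
    -- passes to `φ`.
    have hres : hι.H1Equiv ∘ unitriangular.superdiagH1 φ = χ := by
      funext k i
      rw [Function.comp_apply, hι.H1Equiv_apply, ← congrFun (hψ i) k]
      ext x
      rw [H1.comap_apply, unitriangular.superdiagH1_apply, unitriangular.superdiagH1_apply, hφ]
    refine LinearIndependent.of_comp hι.H1Equiv.toLinearMap ?_
    rw [LinearEquiv.coe_coe, hres]
    exact hχ
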